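/- Let $(\lambda_k)_{k\ge1}$ be a sequence of points of the open unit disk $\mathbb D$ with $|\lambda_k|\le|\lambda_{k+1}|$ for all $k$ and $\sum_k(1-|\lambda_k|)<\infty$. Put $b_0(z)=z$ and $b_\lambda(z)=\frac{\lambda-z}{1-\bar\lambda z}\,\frac{|\lambda|}{\lambda}$ for $\lambda\in\mathbb D\setminus\{0\}$, and let $u=\prod_{k=1}^\infty b_{\lambda_k}$ be the associated infinite Blaschke product and $u_n=\prod_{k=1}^n b_{\lambda_k}$ its partial products. Identify the Hardy space $H^2$ with a closed subspace of $L^2(\mathbb T)$ (normalized Lebesgue measure) by passing to boundary functions, $\sum_{k\ge0} a_kz^k\mapsto\sum_{k\ge0} a_kt^k$. For an inner function $v$ let $K_v^2=H^2\ominus vH^2$ be the model space, and let $P_v$ be the orthogonal projection of $L^2(\mathbb T)$ onto $K^2_v$. For $a\in C(\mathbb T)$ let $T_u(a)f=P_u(af)$, $f\in K^2_u$, be the truncated Toeplitz operator on $K^2_u$. Then the (restrictions to $K_u^2$ of the) projections $P_{u_n}$, $n\ge1$, form a filtration $\mathcal P_u$ on $K^2_u$, i.e. they are orthogonal projections of finite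 rank which converge strongly to the identity. Let $\mathcal F$ be the $C^*$-algebra (element-wise operations, supremum norm) of all sequences $(A_n)_{n\ge1}$ of operators $A_n:\operatorname{im}P_{u_n}\to\operatorname{im}P_{u_n}$ for which $(A_nP_{u_n})$ converges $^*$-strongly to a bounded operator on $K^2_u$, let $\mathcal G\subset\mathcal F$ be the ideal of the sequences with $\|A_n\|\to0$, and let $\mathcal S(\mathcal T_u(C))$ be the smallest closed subalgebra of $\mathcal F$ which contains all sequences $(P_{u_n}(T_u(a)+K)P_{u_n})_{n\ge1}$ with $a\in C(\mathbb T)$ and $K$ a compact operator on $K^2_u$ (these sequences do belong to $\mathcal F$). The algebra $\mathcal S=\mathcal S(\mathcal T_u(C))$ is fractal: for every strictly increasing $\eta:\mathbb N\to\mathbb N$, with $R_\eta:(A_n)\mapsto(A_{\eta(n)})$ the restriction map, there is a $^*$-homomorphism $\pi_\eta:R_\eta(\mathcal S)\to\mathcal S/(\mathcal S\cap\mathcal G)$ such that $\pi_\eta\circ R_\eta$ is the canonical homomorphism $\pi:\mathcal S\to\mathcal S/(\mathcal S\cap\mathcal G)$. -/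

import Mathlib

open MeasureTheory Filter Topology AddCircle
open scoped ENNReal ComplexConjugate

noncomputable section

/-! ## Sequences of elements of C*-algebras and fractality -/

section Fractal

variable {E : ℕ → Type} [∀ n, CStarAlgebra (E n)]

/-- The C*-algebra of all bounded sequences `(A_n)` with `A_n ∈ E n`, with element-wise operations
and the supremum norm. -/
def BddSeq (E : ℕ → Type) [∀ n, CStarAlgebra (E n)] : Type := lp E ∞

namespace BddSeq

variable (E : ℕ → Type) [∀ n, CStarAlgebra (E n)]

instance : NonUnitalNormedRing (BddSeq E) := inferInstanceAs (NonUnitalNormedRing (lp E ∞))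
instance : StarRing (BddSeq E) := inferInstanceAs (StarRing (lp E ∞))
instance : CompleteSpace (BddSeq E) := inferInstanceAs (CompleteSpace (lp E ∞))
instance : CStarRing (BddSeq E) := inferInstanceAs (CStarRing (lp E ∞))
instance : NormedSpace ℂ (BddSeq E) := inferInstanceAs (NormedSpace ℂ (lp E ∞))
instance : IsScalarTower ℂ (BddSeq E) (BddSeq E) :=
  inferInstanceAs (IsScalarTower ℂ (lp E ∞) (lp E ∞))
instance : SMulCommClass ℂ (BddSeq E) (BddSeq E) :=
  inferInstanceAs (SMulCommClass ℂ (lp E ∞) (lp E ∞))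
instance : StarModule ℂ (BddSeq E) := inferInstanceAs (StarModule ℂ (lp E ∞))
instance : NonUnitalCStarAlgebra (BddSeq E) where

variable {E}

instance : CoeFun (BddSeq E) fun _ => ∀ n, E n := ⟨fun A => (show lp E ∞ from A).1⟩

/-- A bounded sequence as an element of `BddSeq E`. -/
def mk (A : ∀ n, E n) (C : ℝ) (h : ∀ n, ‖A n‖ ≤ C) : BddSeq E :=
  (⟨A, memℓp_infty ⟨C, by rintro _ ⟨n, rfl⟩; exact h n⟩⟩ : lp E ∞)

@[simp] theorem mk_apply (A : ∀ n, E n) (C : ℝ) (h : ∀ n, ‖A n‖ ≤ C) (n : ℕ) :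
    mk A C h n = A n := rfl
@[simp] theorem add_apply (A B : BddSeq E) (n : ℕ) : (A + B) n = A n + B n := rfl
@[simp] theorem sub_apply (A B : BddSeq E) (n : ℕ) : (A - B) n = A n - B n := rfl
@[simp] theorem neg_apply (A : BddSeq E) (n : ℕ) : (-A) n = -A n := rfl
@[simp] theorem zero_apply (n : ℕ) : (0 : BddSeq E) n = 0 := rfl
@[simp] theorem mul_apply (A B : BddSeq E) (n : ℕ) : (A * B) n = A n * B n := rfl
@[simp] theorem smul_apply (c : ℂ) (A : BddSeq E) (n : ℕ) : (c • A) n = c • A n := rfl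
@[simp] theorem star_apply (A : BddSeq E) (n : ℕ) : (star A) n = star (A n) := rfl

theorem norm_apply_le (A : BddSeq E) (n : ℕ) : ‖A n‖ ≤ ‖A‖ :=
  lp.norm_apply_le_norm ENNReal.top_ne_zero (show lp E ∞ from A) n

theorem norm_le {A : BddSeq E} {C : ℝ} (hC : 0 ≤ C) (h : ∀ n, ‖A n‖ ≤ C) : ‖A‖ ≤ C :=
  lp.norm_le_of_forall_le hC h

theorem ext {A B : BddSeq E} (h : ∀ n, A n = B n) : A = B :=
  Subtype.ext (funext h)

end BddSeq

/-- The restriction map `R_η : (A_n) ↦ (A_{η(n)})` on bounded sequences. -/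
def restrictSeq (η : ℕ → ℕ) : BddSeq E →⋆ₙₐ[ℂ] BddSeq (fun n => E (η n)) where
  toFun A := BddSeq.mk (fun n => A (η n)) ‖A‖ fun n => A.norm_apply_le (η n)
  map_smul' _ _ := rfl
  map_zero' := rfl
  map_add' _ _ := rfl
  map_mul' _ _ := rfl
  map_star' _ := rfl

@[simp] theorem restrictSeq_apply (η : ℕ → ℕ) (A : BddSeq E) (n : ℕ) :
    restrictSeq η A n = A (η n) := rfl

variable (S : NonUnitalStarSubalgebra ℂ (BddSeq E))

/-- The ideal `S ∩ G` of `S`, where `G` is the set of the sequences which tend to zero in the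
norm. -/
def nullIdeal : TwoSidedIdeal S :=
  TwoSidedIdeal.mk' {A : S | Tendsto (fun n => ‖(A : BddSeq E) n‖) atTop (𝓝 0)}
    (by simp)
    (by
      intro A B hA hB
      refine squeeze_zero (fun _ => norm_nonneg _) (fun n => ?_) (by simpa using hA.add hB)
      exact norm_add_le _ _)
    (by
      intro A hA
      simpa using hA)
    (by
      intro A B hB
      refine squeeze_zero (fun _ => norm_nonneg _) (fun n => ?_)
        (by simpa using hB.const_mul ‖(A : BddSeq E)‖)
      refine (norm_mul_le _ _).trans ?_
      gcongr
      exact BddSeq.norm_apply_le _ n)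
    (by
      intro A B hA
      refine squeeze_zero (fun _ => norm_nonneg _) (fun n => ?_)
        (by simpa using hA.mul_const ‖(B : BddSeq E)‖)
      refine (norm_mul_le _ _).trans ?_
      gcongr
      exact BddSeq.norm_apply_le _ n)

theorem mem_nullIdeal (A : S) :
    A ∈ nullIdeal S ↔ Tendsto (fun n => ‖(A : BddSeq E) n‖) atTop (𝓝 0) :=
  TwoSidedIdeal.mem_mk' _ _ _ _ _ _ _

theorem smul_mem_nullIdeal (c : ℂ) {A : S} (hA : A ∈ nullIdeal S) : c • A ∈ nullIdeal S := by
  rw [mem_nullIdeal] at hA ⊢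
  simpa [norm_smul] using hA.const_mul ‖c‖

theorem star_mem_nullIdeal {A : S} (hA : A ∈ nullIdeal S) : star A ∈ nullIdeal S := by
  rw [mem_nullIdeal] at hA ⊢
  simpa using hA

/-- The quotient `S / (S ∩ G)`, as a *-algebra. -/
def NullQuotient : Type := (nullIdeal S).ringCon.Quotient

namespace NullQuotient

instance : NonUnitalRing (NullQuotient S) :=
  inferInstanceAs (NonUnitalRing (nullIdeal S).ringCon.Quotient)

/-- The coset of `A` modulo `S ∩ G`. -/
def coset (A : S) : NullQuotient S := (A : (nullIdeal S).ringCon.Quotient)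

variable {S}

theorem coset_surjective : Function.Surjective (coset S) := Quotient.mk''_surjective

theorem coset_eq_coset {A B : S} : coset S A = coset S B ↔ A - B ∈ nullIdeal S :=
  ((nullIdeal S).ringCon.eq).trans ((nullIdeal S).rel_iff A B)

theorem coset_add (A B : S) : coset S (A + B) = coset S A + coset S B := rfl

theorem coset_mul (A B : S) : coset S (A * B) = coset S A * coset S B := rfl

theorem coset_zero : coset S 0 = 0 := rfl

instance : SMul ℂ (NullQuotient S) where
  smul c := Quotient.map' (fun A => c • A) fun A B h => by
    refine ((nullIdeal S).rel_iff _ _).2 ?_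
    rw [← smul_sub]
    exact smul_mem_nullIdeal S c (((nullIdeal S).rel_iff A B).1 h)

instance : Star (NullQuotient S) where
  star := Quotient.map' (fun A => star A) fun A B h => by
    refine ((nullIdeal S).rel_iff _ _).2 ?_
    have e : star A - star B = star (A - B) := Subtype.ext (star_sub (A : BddSeq E) B).symm
    rw [e]
    exact star_mem_nullIdeal S (((nullIdeal S).rel_iff A B).1 h)

theorem coset_smul (c : ℂ) (A : S) : coset S (c • A) = c • coset S A := rfl

theorem coset_star (A : S) : coset S (star A) = star (coset S A) := rfl

instance : Module ℂ (NullQuotient S) where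
  one_smul x := by
    obtain ⟨A, rfl⟩ := coset_surjective x
    rw [← coset_smul, one_smul]
  mul_smul c d x := by
    obtain ⟨A, rfl⟩ := coset_surjective x
    simp only [← coset_smul, mul_smul]
  smul_zero c := by rw [← coset_zero, ← coset_smul, smul_zero]
  smul_add c x y := by
    obtain ⟨A, rfl⟩ := coset_surjective x
    obtain ⟨B, rfl⟩ := coset_surjective y
    simp only [← coset_smul, ← coset_add, smul_add]
  add_smul c d x := by
    obtain ⟨A, rfl⟩ := coset_surjective x
    simp only [← coset_smul, ← coset_add, add_smul]
  zero_smul x := by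
    obtain ⟨A, rfl⟩ := coset_surjective x
    rw [← coset_smul, zero_smul, coset_zero]

instance : StarRing (NullQuotient S) where
  star_involutive x := by
    obtain ⟨A, rfl⟩ := coset_surjective x
    simp only [← coset_star, star_star]
  star_mul x y := by
    obtain ⟨A, rfl⟩ := coset_surjective x
    obtain ⟨B, rfl⟩ := coset_surjective y
    simp only [← coset_star, ← coset_mul, star_mul]
  star_add x y := by
    obtain ⟨A, rfl⟩ := coset_surjective x
    obtain ⟨B, rfl⟩ := coset_surjective y
    simp only [← coset_star, ← coset_add, star_add]

end NullQuotient

/-- The canonical *-homomorphism `π : S → S / (S ∩ G)`. -/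
def canonicalHom : S →⋆ₙₐ[ℂ] NullQuotient S where
  toFun := NullQuotient.coset S
  map_smul' _ _ := rfl
  map_zero' := rfl
  map_add' _ _ := rfl
  map_mul' _ _ := rfl
  map_star' _ := rfl

variable {S}

/-- A *-homomorphism `W` on `S` is fractal if, for each strictly increasing `η`, there is a
*-homomorphism `W_η` on `S_η := R_η(S)` such that `W = W_η ∘ R_η`. -/
def IsFractalHom {B : Type} [NonUnitalRing B] [Module ℂ B] [StarRing B]
    (W : S →⋆ₙₐ[ℂ] B) : Prop :=
  ∀ η : ℕ → ℕ, StrictMono η →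
    ∃ Wη : (S.map (restrictSeq (E := E) η)) →⋆ₙₐ[ℂ] B,
      ∀ A : S, W A = Wη ⟨restrictSeq η (A : BddSeq E), ⟨A, A.2, rfl⟩⟩

variable (S)

/-- The algebra `S` is fractal if the canonical homomorphism `S → S / (S ∩ G)` is fractal. -/
def IsFractal : Prop := IsFractalHom (canonicalHom S)

end Fractal

/-! ## Filtrations and their algebras

A sequence `(P_n)` of orthogonal projections is given by the sequence `V n = im P_n`. -/

section Filtration

variable {H : Type} [NormedAddCommGroup H] [InnerProductSpace ℂ H]

/-- The orthogonal projections onto `V n` have finite rank and tend strongly to the identity. -/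
def IsHilbertFiltration (V : ℕ → Submodule ℂ H) [∀ n, CompleteSpace (V n)] : Prop :=
  (∀ n, FiniteDimensional ℂ (V n)) ∧
    ∀ x : H, Tendsto (fun n => (V n).starProjection x) atTop (𝓝 x)

variable (V : ℕ → Submodule ℂ H) [∀ n, CompleteSpace (V n)]

instance (n : ℕ) : CStarAlgebra (V n →L[ℂ] V n) := inferInstance

/-- The bounded sequences `(A_n)` of operators `A_n : im P_n → im P_n`, with the supremum norm. -/
abbrev OpSeq : Type := BddSeq (fun n => V n →L[ℂ] V n)

/-- `(A_n P_n)` converges strongly to `W`. -/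
def StrongLimit (A : OpSeq V) (W : H →L[ℂ] H) : Prop :=
  ∀ x : H, Tendsto (fun n => ((A n ((V n).orthogonalProjectionOnto x) : V n) : H))
    atTop (𝓝 (W x))

variable {V}

theorem StrongLimit.add {A B : OpSeq V} {W X : H →L[ℂ] H} (hA : StrongLimit V A W)
    (hB : StrongLimit V B X) : StrongLimit V (A + B) (W + X) := fun x => by
  simpa using (hA x).add (hB x)

theorem StrongLimit.smul (c : ℂ) {A : OpSeq V} {W : H →L[ℂ] H} (hA : StrongLimit V A W) :
    StrongLimit V (c • A) (c • W) := fun x => by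
  simpa using (hA x).const_smul c

theorem StrongLimit.mul {A B : OpSeq V} {W X : H →L[ℂ] H} (hA : StrongLimit V A W)
    (hB : StrongLimit V B X) : StrongLimit V (A * B) (W * X) := fun x => by
  have h1 := hA (X x)
  have h2 : Tendsto (fun n => ((A n (B n ((V n).orthogonalProjectionOnto x)
      - (V n).orthogonalProjectionOnto (X x)) : V n) : H)) atTop (𝓝 0) := by
    have h3 : Tendsto (fun n => ‖A‖ * ‖((B n ((V n).orthogonalProjectionOnto x) : V n) : H)
        - X x‖) atTop (𝓝 0) := by
      simpa using (tendsto_iff_norm_sub_tendsto_zero.1 (hB x)).const_mul ‖A‖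
    refine squeeze_zero_norm (fun n => ?_) h3
    have h4 : B n ((V n).orthogonalProjectionOnto x) - (V n).orthogonalProjectionOnto (X x)
        = (V n).orthogonalProjectionOnto
          (((B n ((V n).orthogonalProjectionOnto x) : V n) : H) - X x) := by
      rw [map_sub, Submodule.orthogonalProjectionOnto_mem_subspace_eq_self]
    rw [h4]
    refine ((A n).le_opNorm _).trans ?_
    gcongr
    · exact A.norm_apply_le n
    · exact (V n).norm_orthogonalProjectionOnto_apply_le _
  have h5 := h2.add h1
  simp only [zero_add] at h5
  refine h5.congr fun n => ?_
  rw [map_sub, Submodule.coe_sub, sub_add_cancel]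
  rfl

variable (V)

/-- The algebra of all sequences `(A_n)` of operators `A_n : im P_n → im P_n` such that
`(A_n P_n)` converges *-strongly to an operator on `H`. (Such sequences are bounded by the uniform
boundedness principle.) -/
def convergentAlgebra [CompleteSpace H] : NonUnitalStarSubalgebra ℂ (OpSeq V) where
  carrier := {A | ∃ W : H →L[ℂ] H, StrongLimit V A W ∧
    StrongLimit V (star A) (ContinuousLinearMap.adjoint W)}
  zero_mem' := ⟨0, fun x => by simp, fun x => by simp⟩
  add_mem' := by
    rintro A B ⟨W, h1, h2⟩ ⟨X, h3, h4⟩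
    refine ⟨W + X, h1.add h3, ?_⟩
    rw [star_add, map_add]
    exact h2.add h4
  smul_mem' := by
    rintro c A ⟨W, h1, h2⟩
    refine ⟨c • W, h1.smul c, ?_⟩
    rw [star_smul, map_smulₛₗ]
    exact h2.smul _
  mul_mem' := by
    rintro A B ⟨W, h1, h2⟩ ⟨X, h3, h4⟩
    refine ⟨W * X, h1.mul h3, ?_⟩
    rw [star_mul, ContinuousLinearMap.mul_def, ContinuousLinearMap.adjoint_comp]
    exact h4.mul h2
  star_mem' := by
    rintro A ⟨W, h1, h2⟩
    refine ⟨ContinuousLinearMap.adjoint W, h2, ?_⟩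
    simpa using h1

/-- The sequence `(P_n A P_n)` of the finite sections of `A`. -/
def finiteSections (A : H →L[ℂ] H) : OpSeq V :=
  BddSeq.mk (fun n => (V n).orthogonalProjectionOnto ∘L A ∘L (V n).subtypeL) ‖A‖ fun n => by
    refine ContinuousLinearMap.opNorm_le_bound _ (norm_nonneg A) fun x => ?_
    exact ((V n).norm_orthogonalProjectionOnto_apply_le _).trans (A.le_opNorm _)

end Filtration

/-! ## Hardy space, model spaces and truncated Toeplitz operators

The unit circle is parametrized by `ℝ/ℤ` via `t = exp(2πix)`, so that `fourier n` is `t ↦ t ^ n`. -/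

/-- `L²` of the unit circle with respect to the normalized Lebesgue measure. -/
abbrev L2Circle : Type := Lp ℂ 2 (haarAddCircle (T := (1 : ℝ)))

/-- The Hardy space, as a subspace of `L²`: the functions without negative Fourier coefficients. -/
def hardySpace : Submodule ℂ L2Circle where
  carrier := {f | ∀ n : ℤ, n < 0 → fourierBasis.repr f n = 0}
  zero_mem' := fun n _ => by simp
  add_mem' := fun hf hg n hn => by simp [hf n hn, hg n hn]
  smul_mem' := fun c f hf n hn => by simp [hf n hn]

/-- The boundary function `∑ aₙ tⁿ ∈ L²` of a holomorphic function `f(z) = ∑ aₙ zⁿ` on the unit disk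
with square-summable Taylor coefficients. -/
def boundaryFunction (f : ℂ → ℂ) : L2Circle :=
  ∑' n : ℕ, (iteratedDeriv n f 0 / (n.factorial : ℂ)) • fourierLp 2 (n : ℤ)

/-- The space `u H²` of all products of the function `u` on the circle with functions in `H²`. -/
def mulHardySpace (u : AddCircle (1 : ℝ) → ℂ) : Submodule ℂ L2Circle where
  carrier := {g | ∃ f ∈ hardySpace, g =ᵐ[haarAddCircle] fun t => u t * f t}
  zero_mem' := ⟨0, zero_mem _, by
    filter_upwards [Lp.coeFn_zero ℂ 2 (haarAddCircle (T := (1 : ℝ)))] with t ht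
    rw [ht]
    simp⟩
  add_mem' := by
    rintro g₁ g₂ ⟨f₁, hf₁, h₁⟩ ⟨f₂, hf₂, h₂⟩
    refine ⟨f₁ + f₂, add_mem hf₁ hf₂, ?_⟩
    filter_upwards [h₁, h₂, Lp.coeFn_add g₁ g₂, Lp.coeFn_add f₁ f₂] with t e₁ e₂ e₃ e₄
    simp only [e₃, e₄, Pi.add_apply, e₁, e₂]
    ring
  smul_mem' := by
    rintro c g ⟨f, hf, h⟩
    refine ⟨c • f, hardySpace.smul_mem c hf, ?_⟩
    filter_upwards [h, Lp.coeFn_smul c g, Lp.coeFn_smul c f] with t e₁ e₂ e₃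
    simp only [e₂, e₃, Pi.smul_apply, e₁, smul_eq_mul]
    ring

/-- The model space `K²_u = H² ⊖ u H²` of an inner function `u` on the disk. -/
def modelSpace (u : ℂ → ℂ) : Submodule ℂ L2Circle :=
  hardySpace ⊓ (mulHardySpace (boundaryFunction u))ᗮ

theorem isClosed_hardySpace : IsClosed (hardySpace : Set L2Circle) := by
  have h : (hardySpace : Set L2Circle)
      = ⋂ n : ℤ, ⋂ _ : n < 0, {f | fourierBasis.repr f n = 0} := by
    ext f
    simp [hardySpace]
  rw [h]
  refine isClosed_iInter fun n => isClosed_iInter fun _ => ?_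
  refine isClosed_eq ?_ continuous_const
  simp only [HilbertBasis.repr_apply_apply]
  fun_prop

theorem isClosed_modelSpace (u : ℂ → ℂ) : IsClosed (modelSpace u : Set L2Circle) :=
  isClosed_hardySpace.inter (Submodule.isClosed_orthogonal _)

instance (u : ℂ → ℂ) : CompleteSpace (modelSpace u) :=
  (isClosed_modelSpace u).completeSpace_coe

/-- The model space `K²_u` as a Hilbert space in its own right. -/
def ModelSpace (u : ℂ → ℂ) : Type := modelSpace u

namespace ModelSpace

variable (u : ℂ → ℂ)

instance : NormedAddCommGroup (ModelSpace u) := inferInstanceAs (NormedAddCommGroup (modelSpace u))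
instance : InnerProductSpace ℂ (ModelSpace u) := inferInstanceAs (InnerProductSpace ℂ (modelSpace u))
instance : CompleteSpace (ModelSpace u) := inferInstanceAs (CompleteSpace (modelSpace u))

/-- The inclusion of `K²_u` into `L²`. -/
def incl : ModelSpace u →L[ℂ] L2Circle := (modelSpace u).subtypeL

/-- The orthogonal projection `P_u` from `L²` onto `K²_u`. -/
def proj : L2Circle →L[ℂ] ModelSpace u := (modelSpace u).orthogonalProjectionOnto

end ModelSpace

/-- The operator of multiplication by `a ∈ L^∞` on `L²`. -/
def mulOp (a : Lp ℂ ∞ (haarAddCircle (T := (1 : ℝ)))) : L2Circle →L[ℂ] L2Circle :=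
  (ContinuousLinearMap.mul ℂ ℂ).holderL haarAddCircle ∞ 2 2 a

/-- The truncated Toeplitz operator `T_u(a) = P_u a I |_{K²_u}` with `a ∈ L^∞`. -/
def truncatedToeplitz (u : ℂ → ℂ) (a : Lp ℂ ∞ (haarAddCircle (T := (1 : ℝ)))) :
    ModelSpace u →L[ℂ] ModelSpace u :=
  ModelSpace.proj u ∘L mulOp a ∘L ModelSpace.incl u

/-! ## Blaschke products and the algebra of the finite sections discretization -/

/-- The Blaschke factor `b_μ`. -/
def blaschkeFactor (μ z : ℂ) : ℂ :=
  if μ = 0 then z else (μ - z) / (1 - conj μ * z) * ((‖μ‖ : ℂ) / μ)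

/-- The infinite Blaschke product `u` with the sequence of zeros `lam 0, lam 1, …`. -/
def blaschkeProduct (lam : ℕ → ℂ) (z : ℂ) : ℂ := ∏' k, blaschkeFactor (lam k) z

/-- The finite Blaschke product with the zeros `lam 0, …, lam (n - 1)`. -/
def partialBlaschke (lam : ℕ → ℂ) (n : ℕ) (z : ℂ) : ℂ :=
  ∏ k ∈ Finset.range n, blaschkeFactor (lam k) z

/-- The filtration of `K²_u`: the `n`th space is `K²_{u_{n+1}}`, regarded as a subspace of `K²_u`,
where `u_{n+1}` is the product of the first `n + 1` Blaschke factors (so the sequence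
`K²_{u_1}, K²_{u_2}, …` is indexed from `0` on). -/
def modelFiltration (lam : ℕ → ℂ) (n : ℕ) : Submodule ℂ (ModelSpace (blaschkeProduct lam)) :=
  (modelSpace (partialBlaschke lam (n + 1))).comap
    (ModelSpace.incl (blaschkeProduct lam)).toLinearMap

instance (lam : ℕ → ℂ) (n : ℕ) : CompleteSpace (modelFiltration lam n) :=
  ((isClosed_modelSpace (partialBlaschke lam (n + 1))).preimage
    (ModelSpace.incl (blaschkeProduct lam)).continuous).completeSpace_coe

/-- The algebra `S(T_u(C))`: the smallest closed subalgebra which contains all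
sequences of finite sections `(P_{u_n} (T_u(a) + K) P_{u_n})` with `a` continuous on the circle and
`K` compact on `K²_u`. (The set of these sequences is invariant under the involution, so the
smallest closed subalgebra and the smallest closed *-subalgebra coincide.) -/
def fsdAlgebra (lam : ℕ → ℂ) : NonUnitalStarSubalgebra ℂ (OpSeq (modelFiltration lam)) :=
  (NonUnitalStarAlgebra.adjoin ℂ
    {A | ∃ (a : C(AddCircle (1 : ℝ), ℂ))
        (K : ModelSpace (blaschkeProduct lam) →L[ℂ] ModelSpace (blaschkeProduct lam)),
      IsCompactOperator K ∧
      A = finiteSections (modelFiltration lam) (truncatedToeplitz (blaschkeProduct lam)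
        (ContinuousMap.toLp ∞ haarAddCircle ℂ a) + K)}).topologicalClosure

end

open MeasureTheory Filter Topology AddCircle
open scoped ENNReal ComplexConjugate

noncomputable section

/-! ## Factorization through the restriction maps -/

section Factorization

variable {E : ℕ → Type} [∀ n, CStarAlgebra (E n)] {S : NonUnitalStarSubalgebra ℂ (BddSeq E)}

/-! Write P_n for the projection onto the n-th model space. The operators W with ‖P_n W - W P_n‖ → 0
form a C*-algebra D. For W and X in D, the sections of W X differ from the product of the sections
of W and X by a null sequence. Hence the sequences (P_n W P_n) + (null sequence) with W in D form a
closed *-algebra. Such a sequence determines W as its strong limit, and W can already be read off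
along any subsequence. If a difference of two sequences vanishes along η, its W is 0, so the
difference is null along the full sequence: every subalgebra is fractal
(`isFractal_of_le_essentialSectionAlgebra`).

It remains to see that D contains the compact operators and all T_u(a). Compact operators belong to
D because P_n → I strongly. For the T_u(a), the compressed shift T = T_u(z) is enough: K²_u ⊖
K²_{u_n} lies in the shift-invariant space u_n H², so P_n T (I - P_n) = 0. For x in K²_{u_n} one has
z x = g + α u_n with g in K²_{u_n} and |α| ≤ ‖x‖, because H² ⊖ z H² consists of constants. As P_u u
= 0, the defect (I - P_n) T P_n has norm at most ‖u_n - u‖ in L²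
(`compression_shift_mem_asymptoticCommutant`). Then T_u(z^k) = T^k, adjoints and the density of the
trigonometric polynomials give all continuous a.

The convergence u_n → u in L² follows from ‖u_m - u_n‖² = 2 - 2 ∏ |λ_k| ≤ 2 ∑ (1 - |λ_k|), taken
over m < k ≤ n. The limit is unimodular almost everywhere, so multiplication by u_n converges
strongly to a surjective isometry. The model space arguments use only such isometries in a Hilbert
space. The limit is matched with the boundary function of the infinite product by evaluating at
points of the disk. -/

/-- A *-homomorphism factors through `R_η` as soon as its values only depend on the restricted
sequences. -/
theorem exists_factorization_of_forall_eq {B : Type} [NonUnitalRing B] [Module ℂ B] [StarRing B]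
    (η : ℕ → ℕ) (W : S →⋆ₙₐ[ℂ] B)
    (h : ∀ A A' : S, restrictSeq η (A : BddSeq E) = restrictSeq η (A' : BddSeq E) → W A = W A') :
    ∃ Wη : (S.map (restrictSeq (E := E) η)) →⋆ₙₐ[ℂ] B,
      ∀ A : S, W A = Wη ⟨restrictSeq η (A : BddSeq E), ⟨A, A.2, rfl⟩⟩ := by
  have hex : ∀ B : S.map (restrictSeq (E := E) η), ∃ A : S, restrictSeq η (A : BddSeq E) = B := by
    rintro ⟨_, A, hA, rfl⟩
    exact ⟨⟨A, hA⟩, rfl⟩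
  choose lift hlift using hex
  -- The value of `W` does not depend on the chosen lift, so each homomorphism law may be checked on
  -- a convenient one.
  have key : ∀ (A : S) (B : S.map (restrictSeq (E := E) η)),
      (B : BddSeq fun n => E (η n)) = restrictSeq η (A : BddSeq E) → W (lift B) = W A :=
    fun A B hB => h _ _ ((hlift B).trans hB)
  refine ⟨{ toFun := fun B => W (lift B)
            map_smul' := fun c B => ?_
            map_zero' := ?_
            map_add' := fun B C => ?_
            map_mul' := fun B C => ?_
            map_star' := fun B => ?_ }, fun A => (key A _ rfl).symm⟩
  · refine (key (c • lift B) _ ?_).trans (map_smul W c _)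
    exact congrArg (c • ·) (hlift B).symm
  · exact (key 0 _ rfl).trans (map_zero W)
  · refine (key (lift B + lift C) _ ?_).trans (map_add W _ _)
    exact congrArg₂ (· + ·) (hlift B).symm (hlift C).symm
  · refine (key (lift B * lift C) _ ?_).trans (map_mul W _ _)
    exact congrArg₂ (· * ·) (hlift B).symm (hlift C).symm
  · refine (key (star (lift B)) _ ?_).trans (map_star W _)
    exact congrArg Star.star (hlift B).symm

end Factorization

/-! ## Operators commuting asymptotically with a filtration -/

section AsymptoticCommutant

variable {H : Type} [NormedAddCommGroup H] [InnerProductSpace ℂ H]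
variable {V : ℕ → Submodule ℂ H} [∀ n, CompleteSpace (V n)]

theorem coe_finiteSections_apply (W : H →L[ℂ] H) (n : ℕ) (x : V n) :
    ((finiteSections V W n x : V n) : H) = (V n).starProjection (W x) := rfl

theorem norm_finiteSections_apply_le (W : H →L[ℂ] H) (n : ℕ) : ‖finiteSections V W n‖ ≤ ‖W‖ :=
  ContinuousLinearMap.opNorm_le_bound _ (norm_nonneg W) fun _ =>
    ((V n).norm_orthogonalProjectionOnto_apply_le _).trans (W.le_opNorm _)

theorem finiteSections_add (W X : H →L[ℂ] H) :
    finiteSections V (W + X) = finiteSections V W + finiteSections V X :=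
  BddSeq.ext fun n => by
    ext x
    simp [coe_finiteSections_apply]

theorem finiteSections_zero_apply (n : ℕ) : finiteSections V (0 : H →L[ℂ] H) n = 0 := by
  ext x
  simp [coe_finiteSections_apply]

theorem finiteSections_sub (W X : H →L[ℂ] H) :
    finiteSections V (W - X) = finiteSections V W - finiteSections V X :=
  BddSeq.ext fun n => by
    ext x
    simp [coe_finiteSections_apply]

theorem finiteSections_smul (c : ℂ) (W : H →L[ℂ] H) :
    finiteSections V (c • W) = c • finiteSections V W :=
  BddSeq.ext fun n => by
    ext x
    simp [coe_finiteSections_apply]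

theorem strongLimit_finiteSections (hV : IsHilbertFiltration V) (W : H →L[ℂ] H) :
    StrongLimit V (finiteSections V W) W := fun x => by
  have h1 : Tendsto (fun n => (V n).starProjection (W ((V n).starProjection x) - W x))
      atTop (𝓝 0) := by
    refine squeeze_zero_norm (fun n => (V n).norm_starProjection_apply_le _) ?_
    simpa using (((W.continuous.tendsto x).comp (hV.2 x)).sub_const (W x)).norm
  have h2 := h1.add (hV.2 (W x))
  rw [zero_add] at h2
  refine h2.congr fun n => ?_
  rw [coe_finiteSections_apply, map_sub, sub_add_cancel]
  rfl

theorem strongLimit_of_tendsto_zero {A : OpSeq V} (hA : Tendsto (fun n => ‖A n‖) atTop (𝓝 0)) :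
    StrongLimit V A 0 := fun x => by
  refine squeeze_zero_norm (fun n => ?_) (by simpa using hA.mul_const ‖x‖)
  refine ((A n).le_opNorm _).trans ?_
  gcongr
  exact (V n).norm_orthogonalProjectionOnto_apply_le _

/-- Passing to the strong limit is contractive; this transfers Cauchy sequences of operator
sequences to their limits. -/
theorem StrongLimit.norm_le {A : OpSeq V} {W : H →L[ℂ] H} (hA : StrongLimit V A W) :
    ‖W‖ ≤ ‖A‖ :=
  ContinuousLinearMap.opNorm_le_bound _ (norm_nonneg A) fun x => by
    refine le_of_tendsto (hA x).norm (Eventually.of_forall fun n => ?_)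
    refine ((A n).le_opNorm _).trans ?_
    gcongr
    · exact A.norm_apply_le n
    · exact (V n).norm_orthogonalProjectionOnto_apply_le _

/-- `(A_n)` is, up to a sequence tending to zero in the norm, the sequence of the finite sections
of `W`. -/
def IsEssentialSection (A : OpSeq V) (W : H →L[ℂ] H) : Prop :=
  Tendsto (fun n => ‖A n - finiteSections V W n‖) atTop (𝓝 0)

/-- Compact operators turn strong convergence of projections into norm convergence. -/
theorem IsCompactOperator.tendsto_starProjection_mul
    (hV : ∀ x : H, Tendsto (fun n => (V n).starProjection x) atTop (𝓝 x))
    {K : H →L[ℂ] H} (hK : IsCompactOperator K) :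
    Tendsto (fun n => (V n).starProjection * K) atTop (𝓝 K) := by
  refine Metric.tendsto_atTop.2 fun ε hε => ?_
  obtain ⟨C, hC, hKC⟩ := hK.image_closedBall_subset_compact (f := K.toLinearMap) 1
  obtain ⟨t, ht, hCt⟩ := Metric.totallyBounded_iff.1 hC.totallyBounded (ε / 4) (by positivity)
  have h1 : ∀ᶠ n in atTop, ∀ y ∈ t, ‖(V n).starProjection y - y‖ < ε / 4 := by
    refine (ht.eventually_all).2 fun y _ => ?_
    simpa [dist_eq_norm] using (Metric.tendsto_nhds.1 (hV y)) (ε / 4) (by positivity)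
  obtain ⟨N, hN⟩ := eventually_atTop.1 h1
  refine ⟨N, fun n hn => ?_⟩
  rw [dist_eq_norm]
  -- A finite ε/4-net of the image of the unit ball reduces uniform convergence to convergence at
  -- finitely many points. The three errors add up to 3ε/4, which leaves room for the strict
  -- inequality.
  refine lt_of_le_of_lt (ContinuousLinearMap.opNorm_le_of_unit_norm (C := 3 * (ε / 4))
    (by positivity) fun x hx => ?_) (by linarith)
  have hx : K x ∈ C := hKC ⟨x, by simp [hx], rfl⟩
  obtain ⟨y, hy, hxy⟩ := Set.mem_iUnion₂.1 (hCt hx)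
  rw [Metric.mem_ball, dist_eq_norm] at hxy
  have e : ((V n).starProjection * K - K) x
      = (V n).starProjection (K x - y) + ((V n).starProjection y - y) + (y - K x) := by
    simp
  rw [e]
  have h2 : ‖(V n).starProjection (K x - y)‖ ≤ ‖K x - y‖ :=
    (V n).norm_starProjection_apply_le _
  have h3 := hN n hn y hy
  have h4 : ‖y - K x‖ < ε / 4 := by rwa [norm_sub_rev]
  refine (norm_add₃_le).trans ?_
  linarith

namespace IsEssentialSection

variable {A B : OpSeq V} {W X : H →L[ℂ] H}

theorem strongLimit (hV : IsHilbertFiltration V) (hA : IsEssentialSection A W) :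
    StrongLimit V A W := by
  have h := (strongLimit_of_tendsto_zero (A := A - finiteSections V W) hA).add
    (strongLimit_finiteSections hV W)
  rwa [sub_add_cancel, zero_add] at h

theorem add (hA : IsEssentialSection A W) (hB : IsEssentialSection B X) :
    IsEssentialSection (A + B) (W + X) := by
  refine squeeze_zero (fun _ => norm_nonneg _) (fun n => ?_) (by simpa using Tendsto.add hA hB)
  rw [finiteSections_add, BddSeq.add_apply, BddSeq.add_apply, add_sub_add_comm]
  exact norm_add_le _ _

theorem sub (hA : IsEssentialSection A W) (hB : IsEssentialSection B X) :
    IsEssentialSection (A - B) (W - X) := by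
  refine squeeze_zero (fun _ => norm_nonneg _) (fun n => ?_) (by simpa using Tendsto.add hA hB)
  rw [finiteSections_sub, BddSeq.sub_apply, BddSeq.sub_apply, sub_sub_sub_comm]
  exact norm_sub_le _ _

theorem smul (c : ℂ) (hA : IsEssentialSection A W) : IsEssentialSection (c • A) (c • W) := by
  have h := Tendsto.const_mul ‖c‖ hA
  rw [mul_zero] at h
  refine h.congr fun n => ?_
  rw [finiteSections_smul, BddSeq.smul_apply, BddSeq.smul_apply, ← smul_sub, norm_smul]

end IsEssentialSection

variable [CompleteSpace H]

theorem adjoint_compression (U : Submodule ℂ H) [CompleteSpace U] (W : H →L[ℂ] H) :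
    star (U.orthogonalProjectionOnto ∘L W ∘L U.subtypeL)
      = U.orthogonalProjectionOnto ∘L star W ∘L U.subtypeL := by
  simp only [ContinuousLinearMap.star_eq_adjoint]
  refine ((ContinuousLinearMap.eq_adjoint_iff _ _).2 fun x y => ?_).symm
  rw [Submodule.coe_inner, Submodule.coe_inner]
  change inner ℂ (U.starProjection (ContinuousLinearMap.adjoint W x)) (y : H)
    = inner ℂ (x : H) (U.starProjection (W y))
  rw [U.inner_starProjection_left_eq_right, U.starProjection_mem_subspace_eq_self y,
    ← U.inner_starProjection_left_eq_right, U.starProjection_mem_subspace_eq_self x,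
    ContinuousLinearMap.adjoint_inner_left]

theorem finiteSections_star (W : H →L[ℂ] H) :
    finiteSections V (star W) = star (finiteSections V W) :=
  BddSeq.ext fun n => (adjoint_compression (V n) W).symm

variable (V)

/-- The algebra of the operators `W` with `‖P_n W - W P_n‖ → 0`. -/
def asymptoticCommutant : StarSubalgebra ℂ (H →L[ℂ] H) where
  carrier := {W | Tendsto (fun n => (V n).starProjection * W - W * (V n).starProjection)
    atTop (𝓝 0)}
  mul_mem' {W X} hW hX := by
    have h := (hW.mul_const X).add (hX.const_mul W)
    simp only [zero_mul, mul_zero, add_zero] at h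
    refine h.congr fun n => ?_
    noncomm_ring
  add_mem' {W X} hW hX := by
    have h := hW.add hX
    rw [add_zero] at h
    refine h.congr fun n => ?_
    noncomm_ring
  algebraMap_mem' c := by
    refine tendsto_const_nhds.congr fun n => ?_
    rw [Algebra.commutes, sub_self]
  star_mem' {W} hW := by
    have h := ((continuous_star.tendsto _).comp hW).neg
    simp only [star_zero, neg_zero] at h
    refine h.congr fun n => ?_
    have hP : star (V n).starProjection = (V n).starProjection :=
      isSelfAdjoint_starProjection (V n)
    simp [hP]

theorem mem_asymptoticCommutant {W : H →L[ℂ] H} : W ∈ asymptoticCommutant V ↔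
    Tendsto (fun n => (V n).starProjection * W - W * (V n).starProjection) atTop (𝓝 0) :=
  Iff.rfl

/-- Since ‖P_n‖ ≤ 1, replacing W by a nearby X changes the commutator with P_n by at most 2‖W - X‖,
uniformly in n. -/
theorem isClosed_asymptoticCommutant :
    IsClosed (asymptoticCommutant V : Set (H →L[ℂ] H)) := by
  refine isClosed_of_closure_subset fun W hW => ?_
  refine Metric.tendsto_atTop.2 fun ε hε => ?_
  obtain ⟨X, hX, hWX⟩ := Metric.mem_closure_iff.1 hW (ε / 4) (by positivity)
  obtain ⟨N, hN⟩ := Metric.tendsto_atTop.1 hX (ε / 4) (by positivity)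
  refine ⟨N, fun n hn => ?_⟩
  have h1 := hN n hn
  rw [dist_zero_right] at h1 ⊢
  rw [dist_eq_norm] at hWX
  have e : (V n).starProjection * W - W * (V n).starProjection
      = ((V n).starProjection * (W - X) - (W - X) * (V n).starProjection)
        + ((V n).starProjection * X - X * (V n).starProjection) := by noncomm_ring
  have hP : ‖(V n).starProjection‖ ≤ 1 := (V n).starProjection_norm_le
  have h2 : ‖(V n).starProjection * (W - X)‖ ≤ ε / 4 :=
    (norm_mul_le _ _).trans (by nlinarith [norm_nonneg (W - X)])
  have h3 : ‖(W - X) * (V n).starProjection‖ ≤ ε / 4 :=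
    (norm_mul_le _ _).trans (by nlinarith [norm_nonneg (W - X)])
  rw [e]
  have h4 := norm_add_le ((V n).starProjection * (W - X) - (W - X) * (V n).starProjection)
    ((V n).starProjection * X - X * (V n).starProjection)
  have h5 := norm_sub_le ((V n).starProjection * (W - X)) ((W - X) * (V n).starProjection)
  linarith

variable {V}

/-- If F and F* are both compact, then P_n F → F and F P_n = (P_n F*)* → F. For a general compact K
this is applied to P_n K, whose adjoint K* P_n visibly has finite rank, and closedness gives K.
Compactness of K* is thus never needed. -/
theorem mem_asymptoticCommutant_of_isCompactOperator (hV : IsHilbertFiltration V)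
    {K : H →L[ℂ] H} (hK : IsCompactOperator K) : K ∈ asymptoticCommutant V := by
  have key : ∀ F : H →L[ℂ] H, IsCompactOperator F → IsCompactOperator (star F : H →L[ℂ] H) →
      F ∈ asymptoticCommutant V := by
    intro F hF hF'
    have h1 := hF.tendsto_starProjection_mul hV.2
    have h2 := (continuous_star.tendsto _).comp (hF'.tendsto_starProjection_mul hV.2)
    have h3 := h1.sub h2
    simp only [star_star, sub_self] at h3
    refine h3.congr fun n => ?_
    have hP : star (V n).starProjection = (V n).starProjection :=
      isSelfAdjoint_starProjection (V n)
    simp [hP]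
  refine (isClosed_asymptoticCommutant V).mem_of_tendsto (hK.tendsto_starProjection_mul hV.2)
    (Eventually.of_forall fun n => ?_)
  have := hV.1 n
  have := FiniteDimensional.proper ℂ (V n)
  have hP : IsCompactOperator (V n).starProjection :=
    (isCompactOperator_of_locallyCompactSpace_rng (V n).subtypeL).comp_clm
      (V n).orthogonalProjectionOnto
  refine key _ (hP.comp_clm K) ?_
  have hP' : star (V n).starProjection = (V n).starProjection :=
    isSelfAdjoint_starProjection (V n)
  rw [star_mul, hP']
  exact hP.clm_comp (star K)

/-! ## Sequences which differ from finite sections by a null sequence -/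

namespace IsEssentialSection

variable {A B : OpSeq V} {W X : H →L[ℂ] H}

theorem star (hA : IsEssentialSection A W) : IsEssentialSection (star A) (star W) := by
  refine Tendsto.congr (fun n => ?_) hA
  rw [finiteSections_star, BddSeq.star_apply, BddSeq.star_apply, ← star_sub, norm_star]

/-- On im P_n one has P W P X - P W X = P W (P X - X P), so only the right factor has to commute
asymptotically with the projections. -/
theorem mul (hA : IsEssentialSection A W) (hB : IsEssentialSection B X)
    (hX : X ∈ asymptoticCommutant V) : IsEssentialSection (A * B) (W * X) := by
  have h1 := (mem_asymptoticCommutant V).1 hX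
  have h2 : Tendsto (fun n => ‖A n - finiteSections V W n‖ * ‖B‖
      + ‖W‖ * ‖B n - finiteSections V X n‖
      + ‖W‖ * ‖(V n).starProjection * X - X * (V n).starProjection‖) atTop (𝓝 0) := by
    simpa using ((Tendsto.mul_const ‖B‖ hA).add (Tendsto.const_mul ‖W‖ hB)).add
      (h1.norm.const_mul ‖W‖)
  refine squeeze_zero (fun _ => norm_nonneg _) (fun n => ?_) h2
  have h3 : ‖finiteSections V W n * finiteSections V X n - finiteSections V (W * X) n‖
      ≤ ‖W‖ * ‖(V n).starProjection * X - X * (V n).starProjection‖ := by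
    refine ContinuousLinearMap.opNorm_le_bound _ (by positivity) fun x => ?_
    have e : (((finiteSections V W n * finiteSections V X n
        - finiteSections V (W * X) n) x : V n) : H)
        = (V n).starProjection
          (W (((V n).starProjection * X - X * (V n).starProjection) x)) := by
      simp [coe_finiteSections_apply, (V n).starProjection_mem_subspace_eq_self x]
    refine (congrArg norm e).trans_le ?_
    rw [mul_assoc]
    refine ((V n).norm_starProjection_apply_le _).trans ((W.le_opNorm _).trans ?_)
    gcongr
    exact ContinuousLinearMap.le_opNorm _ _
  have e : (A * B) n - finiteSections V (W * X) n
      = (A n - finiteSections V W n) * B n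
        + finiteSections V W n * (B n - finiteSections V X n)
        + (finiteSections V W n * finiteSections V X n - finiteSections V (W * X) n) := by
    rw [BddSeq.mul_apply]
    noncomm_ring
  rw [e]
  refine (norm_add₃_le).trans (add_le_add (add_le_add ?_ ?_) h3)
  · refine (norm_mul_le _ _).trans ?_
    gcongr
    exact B.norm_apply_le n
  · refine (norm_mul_le _ _).trans ?_
    gcongr
    exact norm_finiteSections_apply_le W n

end IsEssentialSection

variable (V) in
/-- The algebra of all sequences which are, up to null sequences, finite sections of operators
commuting asymptotically with the filtration. -/
def essentialSectionAlgebra : NonUnitalStarSubalgebra ℂ (OpSeq V) where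
  carrier := {A | ∃ W ∈ asymptoticCommutant V, IsEssentialSection A W}
  zero_mem' := ⟨0, zero_mem _, by
    refine tendsto_const_nhds.congr fun n => ?_
    rw [finiteSections_zero_apply, BddSeq.zero_apply, sub_zero, norm_zero]⟩
  add_mem' := by
    rintro A B ⟨W, hW, hA⟩ ⟨X, hX, hB⟩
    exact ⟨W + X, add_mem hW hX, hA.add hB⟩
  smul_mem' := by
    rintro c A ⟨W, hW, hA⟩
    exact ⟨c • W, SMulMemClass.smul_mem c hW, hA.smul c⟩
  mul_mem' := by
    rintro A B ⟨W, hW, hA⟩ ⟨X, hX, hB⟩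
    exact ⟨W * X, mul_mem hW hX, hA.mul hB hX⟩
  star_mem' := by
    rintro A ⟨W, hW, hA⟩
    exact ⟨star W, star_mem hW, hA.star⟩

/-- If essential sections B_k of W_k converge to A, contractivity of the strong limit makes (W_k)
Cauchy. Its limit X stays in the closed commutant, and comparing A, B_k and the sections of W_k and
X for one good k shows that A belongs to X. -/
theorem isClosed_essentialSectionAlgebra (hV : IsHilbertFiltration V) :
    IsClosed (essentialSectionAlgebra V : Set (OpSeq V)) := by
  refine isClosed_of_closure_subset fun A hA => ?_
  obtain ⟨B, hB, hBA⟩ := mem_closure_iff_seq_limit.1 hA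
  choose W hW hBW using hB
  have hcauchy : CauchySeq W := by
    refine Metric.cauchySeq_iff.2 fun ε hε => ?_
    obtain ⟨N, hN⟩ := Metric.cauchySeq_iff.1 hBA.cauchySeq ε hε
    refine ⟨N, fun k hk l hl => lt_of_le_of_lt ?_ (hN k hk l hl)⟩
    rw [dist_eq_norm, dist_eq_norm]
    exact (((hBW k).sub (hBW l)).strongLimit hV).norm_le
  obtain ⟨X, hX⟩ := cauchySeq_tendsto_of_complete hcauchy
  refine ⟨X, (isClosed_asymptoticCommutant V).mem_of_tendsto hX (Eventually.of_forall hW), ?_⟩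
  refine Metric.tendsto_atTop.2 fun ε hε => ?_
  obtain ⟨k, hk1, hk2⟩ := (((Metric.tendsto_nhds.1 hBA) (ε / 4) (by positivity)).and
    ((Metric.tendsto_nhds.1 hX) (ε / 4) (by positivity))).exists
  obtain ⟨N, hN⟩ := Metric.tendsto_atTop.1 (hBW k) (ε / 4) (by positivity)
  refine ⟨N, fun n hn => ?_⟩
  have h1 := hN n hn
  rw [dist_zero_right, norm_norm] at h1 ⊢
  rw [dist_eq_norm] at hk1 hk2
  have h2 : ‖A n - B k n‖ ≤ ‖B k - A‖ := by
    rw [norm_sub_rev]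
    exact (B k - A).norm_apply_le n
  have h3 : ‖finiteSections V (W k) n - finiteSections V X n‖ ≤ ‖W k - X‖ := by
    have h := norm_finiteSections_apply_le (V := V) (W k - X) n
    rwa [finiteSections_sub, BddSeq.sub_apply] at h
  have e : A n - finiteSections V X n = (A n - B k n) + (B k n - finiteSections V (W k) n)
      + (finiteSections V (W k) n - finiteSections V X n) := by abel
  rw [e]
  refine lt_of_le_of_lt (norm_add₃_le) ?_
  linarith

theorem essentialSectionAlgebra_le_convergentAlgebra (hV : IsHilbertFiltration V) :
    essentialSectionAlgebra V ≤ convergentAlgebra V := by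
  rintro A ⟨W, -, hA⟩
  exact ⟨W, hA.strongLimit hV, hA.star.strongLimit hV⟩

/-- Every algebra of essential sections is fractal. -/
theorem isFractal_of_le_essentialSectionAlgebra (hV : IsHilbertFiltration V)
    {S : NonUnitalStarSubalgebra ℂ (OpSeq V)} (hS : S ≤ essentialSectionAlgebra V) :
    IsFractal S := by
  intro η hη
  refine exists_factorization_of_forall_eq η (canonicalHom S) fun A B h => ?_
  refine NullQuotient.coset_eq_coset.2 ((mem_nullIdeal S _).2 ?_)
  obtain ⟨W, -, hW⟩ := hS (A - B).2
  -- The difference vanishes along η, and its strong limit may be computed along η.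
  have hW0 : W = 0 := by
    ext x
    have h1 := (hW.strongLimit hV x).comp hη.tendsto_atTop
    refine tendsto_nhds_unique h1 (tendsto_const_nhds.congr fun n => ?_)
    have h2 : ((A - B : S) : OpSeq V) (η n) = 0 := by
      have h3 : restrictSeq η (A : OpSeq V) n = restrictSeq η (B : OpSeq V) n := by rw [h]
      exact sub_eq_zero.2 h3
    change (0 : H) = ((((A - B : S) : OpSeq V) (η n) ((V (η n)).orthogonalProjectionOnto x) :
      V (η n)) : H)
    rw [h2]
    rfl
  subst hW0
  refine Tendsto.congr (fun n => ?_) hW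
  rw [finiteSections_zero_apply, sub_zero]

end AsymptoticCommutant

/-! ## Model spaces of isometries in a Hilbert space -/

section IsometryModel

variable {L : Type} [NormedAddCommGroup L] [InnerProductSpace ℂ L] {M : Submodule ℂ L}

/-- The space `M ⊖ U M` for an isometry `U`. -/
def isometryModel (M : Submodule ℂ L) (U : L →ₗᵢ[ℂ] L) : Submodule ℂ L :=
  M ⊓ (M.map U.toLinearMap)ᗮ

theorem mem_isometryModel {U : L →ₗᵢ[ℂ] L} {x : L} :
    x ∈ isometryModel M U ↔ x ∈ M ∧ ∀ y ∈ M, inner ℂ (U y) x = 0 := by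
  simp [isometryModel, Submodule.mem_orthogonal]

theorem isometryModel_mono {U U' : L →ₗᵢ[ℂ] L}
    (h : M.map U'.toLinearMap ≤ M.map U.toLinearMap) :
    isometryModel M U ≤ isometryModel M U' :=
  inf_le_inf_left _ (Submodule.orthogonal_le h)

section Decomposition

variable [CompleteSpace M] {U : L →ₗᵢ[ℂ] L}

/-- The image of the complete space M under an isometry is complete, so the projection onto U M
exists and splits M as (M ⊖ U M) ⊕ U M. -/
theorem exists_isometryModel_add (hU : ∀ x ∈ M, U x ∈ M) {x : L} (hx : x ∈ M) :
    ∃ g ∈ isometryModel M U, ∃ h ∈ M, x = g + U h := by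
  set N := M.map U.toLinearMap with hN
  have hc : IsComplete (N : Set L) :=
    U.isComplete_map_iff.2 (completeSpace_coe_iff_isComplete.1 ‹_›)
  have : CompleteSpace N := completeSpace_coe_iff_isComplete.2 hc
  have hNM : N ≤ M := by
    rintro _ ⟨y, hy, rfl⟩
    exact hU y hy
  obtain ⟨h, hh, hhx⟩ : N.starProjection x ∈ N := N.starProjection_apply_mem x
  refine ⟨x - N.starProjection x, ⟨M.sub_mem hx (hNM (N.starProjection_apply_mem x)),
    N.sub_starProjection_mem_orthogonal x⟩, h, hh, ?_⟩
  have hhx' : U h = N.starProjection x := hhx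
  rw [hhx', sub_add_cancel]

theorem mem_map_of_orthogonal_isometryModel (hU : ∀ x ∈ M, U x ∈ M) {x : L} (hx : x ∈ M)
    (hxK : ∀ y ∈ isometryModel M U, inner ℂ y x = 0) : x ∈ M.map U.toLinearMap := by
  obtain ⟨g, hg, h, hh, rfl⟩ := exists_isometryModel_add hU hx
  have h1 := hxK g hg
  have h2 : inner ℂ g (U h) = 0 := inner_eq_zero_symm.1 ((mem_isometryModel.1 hg).2 h hh)
  rw [inner_add_right, h2, add_zero, inner_self_eq_zero] at h1
  subst h1
  exact ⟨h, hh, (zero_add _).symm⟩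

/-- A shift `S` maps `M ⊖ U M` into `(M ⊖ U M) + ℂ U e` if `M ⊖ S M` is spanned by `e`. -/
theorem exists_shift_eq_add_smul (hU : ∀ x ∈ M, U x ∈ M) {S : L →ₗᵢ[ℂ] L} {e : L}
    (hSM : ∀ x ∈ M, S x ∈ M) (hSU : ∀ x, S (U x) = U (S x)) (he : ‖e‖ = 1)
    (hSe : isometryModel M S ≤ Submodule.span ℂ {e}) {x : L} (hx : x ∈ isometryModel M U) :
    ∃ g ∈ isometryModel M U, ∃ α : ℂ, ‖α‖ ≤ ‖x‖ ∧ S x = g + α • U e := by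
  rw [mem_isometryModel] at hx
  obtain ⟨g, hg, h, hh, hgh⟩ := exists_isometryModel_add hU (hSM x hx.1)
  have hg' := (mem_isometryModel.1 hg).2
  -- ⟨S k, h⟩ = ⟨U S k, U h⟩ = ⟨U S k, S x - g⟩ = ⟨S U k, S x⟩ = ⟨U k, x⟩ = 0, using that g is
  -- orthogonal to U M and that S commutes with U.
  have h1 : h ∈ isometryModel M S := by
    refine mem_isometryModel.2 ⟨hh, fun k hk => ?_⟩
    rw [← U.inner_map_map, ← sub_eq_iff_eq_add'.2 hgh, inner_sub_right, hg' _ (hSM k hk),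
      ← hSU, S.inner_map_map, hx.2 k hk, sub_zero]
  obtain ⟨α, rfl⟩ := Submodule.mem_span_singleton.1 (hSe h1)
  refine ⟨g, hg, α, ?_, by rw [hgh, map_smul]⟩
  -- Pythagoras for the orthogonal pieces g and α U e bounds |α| by ‖S x‖ = ‖x‖.
  have h2 : ‖S x‖ * ‖S x‖ = ‖g‖ * ‖g‖ + ‖U (α • e)‖ * ‖U (α • e)‖ := by
    rw [hgh]
    exact norm_add_sq_eq_norm_sq_add_norm_sq_of_inner_eq_zero _ _
      (inner_eq_zero_symm.1 (hg' _ hh))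
  rw [S.norm_map, U.norm_map, norm_smul, he, mul_one] at h2
  refine le_of_sq_le_sq ?_ (norm_nonneg x)
  nlinarith [mul_self_nonneg ‖g‖]

/-- The analogue of K²_{vw} = K²_v ⊕ v K²_w; it lets finite dimensionality be proved one Blaschke
factor at a time. -/
theorem isometryModel_comp_le (hU : ∀ x ∈ M, U x ∈ M) {B : L →ₗᵢ[ℂ] L}
    (hB : ∀ x ∈ M, B x ∈ M) :
    isometryModel M (U.comp B)
      ≤ isometryModel M U ⊔ (isometryModel M B).map U.toLinearMap := by
  intro x hx
  rw [mem_isometryModel] at hx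
  obtain ⟨g, hg, h, hh, rfl⟩ := exists_isometryModel_add hU hx.1
  refine Submodule.add_mem_sup hg ⟨h, ?_, rfl⟩
  refine mem_isometryModel.2 ⟨hh, fun y hy => ?_⟩
  have h1 := hx.2 y hy
  rw [inner_add_right] at h1
  rw [← U.inner_map_map]
  simpa [(mem_isometryModel.1 hg).2 _ (hB y hy)] using h1

theorem finiteDimensional_isometryModel_comp (hU : ∀ x ∈ M, U x ∈ M) {B : L →ₗᵢ[ℂ] L}
    (hB : ∀ x ∈ M, B x ∈ M) [FiniteDimensional ℂ (isometryModel M U)]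
    [FiniteDimensional ℂ (isometryModel M B)] :
    FiniteDimensional ℂ (isometryModel M (U.comp B)) :=
  Submodule.finiteDimensional_of_le (isometryModel_comp_le hU hB)

end Decomposition

/-! ### Strongly convergent sequences of isometries -/

section Limit

variable [CompleteSpace M] {U : ℕ → L →ₗᵢ[ℂ] L} {W : L →ₗᵢ[ℂ] L}

/-- From index n on, all U_m x lie in the closed space U_n M, and so does their limit W x. -/
theorem map_le_map_of_tendsto (hanti : Antitone fun n => M.map (U n).toLinearMap)
    (hlim : ∀ x, Tendsto (fun n => U n x) atTop (𝓝 (W x))) (n : ℕ) :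
    M.map W.toLinearMap ≤ M.map (U n).toLinearMap := by
  rintro _ ⟨x, hx, rfl⟩
  have hc : IsComplete (M.map (U n).toLinearMap : Set L) :=
    (U n).isComplete_map_iff.2 (completeSpace_coe_iff_isComplete.1 ‹_›)
  refine hc.isClosed.mem_of_tendsto (hlim x) ?_
  filter_upwards [eventually_ge_atTop n] with m hm
  exact hanti hm ⟨x, hx, rfl⟩

/-- Write x = W y. For z ⊥ M, ⟨U_n z, W y⟩ = 0 because W y lies in U_n M, and the limit gives ⟨z, y⟩
= 0. So y is in M, and x lies both in W M and in its orthogonal complement. -/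
theorem eq_zero_of_forall_mem_map (hlim : ∀ x, Tendsto (fun n => U n x) atTop (𝓝 (W x)))
    (hW : Function.Surjective W) {x : L} (hx : x ∈ isometryModel M W)
    (hxU : ∀ n, x ∈ M.map (U n).toLinearMap) : x = 0 := by
  obtain ⟨y, rfl⟩ := hW x
  have hy : y ∈ M := by
    rw [← Submodule.orthogonal_orthogonal M]
    refine (Submodule.mem_orthogonal _ _).2 fun z hz => ?_
    have h1 : Tendsto (fun n => inner ℂ (U n z) (W y)) atTop (𝓝 (inner ℂ (W z) (W y))) :=
      (hlim z).inner tendsto_const_nhds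
    rw [W.inner_map_map] at h1
    refine tendsto_nhds_unique h1 (tendsto_const_nhds.congr fun n => ?_)
    obtain ⟨g, hg, hgy⟩ := hxU n
    have hgy' : U n g = W y := hgy
    rw [← hgy', (U n).inner_map_map]
    exact (Submodule.mem_orthogonal' _ _ |>.1 hz g hg).symm
  exact inner_self_eq_zero.1 ((mem_isometryModel.1 hx).2 y hy)

/-! ### The model space M ⊖ W M as an abstract space H, with isometric inclusion ι and its adjoint p
-/

variable {H : Type} [NormedAddCommGroup H] [InnerProductSpace ℂ H]
  {ι : H →L[ℂ] L} {p : L →L[ℂ] H}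
  (hι : ∀ x, ι x ∈ isometryModel M W) (hιs : ∀ y ∈ isometryModel M W, ∃ x, ι x = y)
  (hι1 : ∀ x, ‖ι x‖ = ‖x‖) (hp : ∀ x y, inner ℂ x (p y) = inner ℂ (ι x) y)

include hι1 in
theorem inner_embedding (x y : H) : inner ℂ (ι x) (ι y) = inner ℂ x y :=
  (⟨ι.toLinearMap, hι1⟩ : H →ₗᵢ[ℂ] L).inner_map_map x y

include hι1 hp in
theorem proj_embedding (x : H) : p (ι x) = x :=
  ext_inner_left ℂ fun y => by rw [hp, inner_embedding hι1]

include hι1 hp in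
theorem norm_proj_le (y : L) : ‖p y‖ ≤ ‖y‖ := by
  by_contra! h
  have h1 : ‖p y‖ * ‖p y‖ ≤ ‖p y‖ * ‖y‖ := by
    rw [← inner_self_eq_norm_mul_norm (𝕜 := ℂ), hp]
    refine (RCLike.re_le_norm _).trans ((norm_inner_le_norm _ _).trans ?_)
    rw [hι1]
  have h2 : 0 < ‖p y‖ := (norm_nonneg y).trans_lt h
  nlinarith

variable {V : ℕ → Submodule ℂ H}
  (hV : ∀ n x, x ∈ V n ↔ ι x ∈ isometryModel M (U n))
  (hanti : Antitone fun n => M.map (U n).toLinearMap)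
  (hlim : ∀ x, Tendsto (fun n => U n x) atTop (𝓝 (W x)))
  (hUM : ∀ n, ∀ x ∈ M, U n x ∈ M)

include hι hιs hι1 hV hanti hlim hUM in
-- M ⊖ U_n M is contained in M ⊖ W M, the range of ι, so orthogonality to V_n inside H is
-- orthogonality to all of M ⊖ U_n M; what remains of M is U_n M.
theorem embedding_mem_map_of_mem_orthogonal {n : ℕ} {x : H} (hx : x ∈ (V n)ᗮ) :
    ι x ∈ M.map (U n).toLinearMap := by
  refine mem_map_of_orthogonal_isometryModel (hUM n) (mem_isometryModel.1 (hι x)).1 fun y hy => ?_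
  obtain ⟨z, rfl⟩ := hιs y (isometryModel_mono (map_le_map_of_tendsto hanti hlim n) hy)
  rw [inner_embedding hι1]
  exact (Submodule.mem_orthogonal _ _).1 hx z ((hV n z).2 hy)

variable [∀ n, CompleteSpace (V n)]

include hι hιs hι1 hV hanti hlim hUM in
theorem isHilbertFiltration_of_isometries [CompleteSpace H] (hW : Function.Surjective W)
    (hfin : ∀ n, FiniteDimensional ℂ (isometryModel M (U n))) : IsHilbertFiltration V := by
  refine ⟨fun n => ?_, fun x => Submodule.starProjection_tendsto_self V ?_ x ?_⟩
  · have := hfin n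
    have hinj : Function.Injective ι := (⟨ι.toLinearMap, hι1⟩ : H →ₗᵢ[ℂ] L).injective
    refine FiniteDimensional.of_injective
      (ι.toLinearMap.restrict fun x hx => (hV n x).1 hx : V n →ₗ[ℂ] isometryModel M (U n))
      fun x y hxy => Subtype.ext (hinj (congrArg Subtype.val hxy))
  · intro m n hmn x hx
    exact (hV n x).2 (isometryModel_mono (hanti hmn) ((hV m x).1 hx))
  · rw [top_le_iff, Submodule.topologicalClosure_eq_top_iff, Submodule.eq_bot_iff]
    intro x hx
    have h0 : ι x = 0 := eq_zero_of_forall_mem_map hlim hW (hι x) fun n =>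
      embedding_mem_map_of_mem_orthogonal hι hιs hι1 hV hanti hlim hUM
        (Submodule.orthogonal_le (le_iSup V n) hx)
    rw [← norm_eq_zero, ← hι1, h0, norm_zero]

variable {S : L →ₗᵢ[ℂ] L} (hSM : ∀ x ∈ M, S x ∈ M)

include hι hιs hι1 hp hV hanti hlim hUM hSM in
/-- The compression of a shift commutes asymptotically with the filtration by model spaces. -/
theorem compression_shift_mem_asymptoticCommutant [CompleteSpace H]
    (hSU : ∀ n x, S (U n x) = U n (S x)) {e : L} (heM : e ∈ M) (he : ‖e‖ = 1)
    (hSe : isometryModel M S ≤ Submodule.span ℂ {e}) :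
    p ∘L S.toContinuousLinearMap ∘L ι ∈ asymptoticCommutant V := by
  set T : H →L[ℂ] H := p ∘L S.toContinuousLinearMap ∘L ι with hT
  rw [mem_asymptoticCommutant]
  -- The abstract form of P_u u = 0; it allows U_n e to be replaced by U_n e - W e below.
  have hpW : p (W e) = 0 := ext_inner_left ℂ fun y => by
    rw [hp, inner_zero_right]
    exact inner_eq_zero_symm.1 ((mem_isometryModel.1 (hι y)).2 e heM)
  -- The complement of V_n embeds into U_n M, which is invariant under S and orthogonal to V_n.
  have hperp : ∀ n, ∀ x ∈ (V n)ᗮ, (V n).starProjection (T x) = 0 := by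
    intro n x hx
    rw [Submodule.starProjection_apply_eq_zero_iff]
    refine (Submodule.mem_orthogonal _ _).2 fun y hy => ?_
    obtain ⟨k, hk, hkx⟩ := embedding_mem_map_of_mem_orthogonal hι hιs hι1 hV hanti hlim hUM hx
    have hkx' : U n k = ι x := hkx
    have hy' := (mem_isometryModel.1 ((hV n y).1 hy)).2 _ (hSM k hk)
    change inner ℂ y (p (S (ι x))) = 0
    rw [hp, ← hkx', hSU]
    exact inner_eq_zero_symm.1 hy'
  -- S x leaves V_n only through the component α U_n e, of which p sees α (U_n e - W e).
  have hin : ∀ n, ∀ x ∈ V n, ‖T x - (V n).starProjection (T x)‖ ≤ ‖x‖ * ‖U n e - W e‖ := by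
    intro n x hx
    obtain ⟨g, hg, α, hα, hxg⟩ := exists_shift_eq_add_smul (hUM n) hSM (hSU n) he hSe
      ((hV n x).1 hx)
    rw [hι1] at hα
    obtain ⟨z, rfl⟩ := hιs g (isometryModel_mono (map_le_map_of_tendsto hanti hlim n) hg)
    have hz : z ∈ V n := (hV n z).2 hg
    have h1 : T x = z + α • p (U n e - W e) := by
      change p (S (ι x)) = _
      rw [hxg, map_add, map_smul, proj_embedding hι1 hp, map_sub, hpW, sub_zero]
    have h2 : T x - (V n).starProjection (T x)
        = α • (V n)ᗮ.starProjection (p (U n e - W e)) := by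
      rw [Submodule.starProjection_orthogonal_val, h1, map_add, map_smul,
        (V n).starProjection_eq_self_iff.2 hz, smul_sub]
      abel
    rw [h2, norm_smul]
    gcongr
    exact ((V n)ᗮ.norm_starProjection_apply_le _).trans (norm_proj_le hι1 hp _)
  refine squeeze_zero_norm (fun n => ?_) (tendsto_iff_norm_sub_tendsto_zero.1 (hlim e))
  refine ContinuousLinearMap.opNorm_le_bound _ (norm_nonneg _) fun x => ?_
  set y := (V n).starProjection x with hy
  have hyV : y ∈ V n := (V n).starProjection_apply_mem x
  have h1 : (V n).starProjection (T x) = (V n).starProjection (T y) := by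
    rw [← sub_eq_zero, ← map_sub, ← map_sub]
    exact hperp n _ ((V n).sub_starProjection_mem_orthogonal x)
  have h2 : ((V n).starProjection * T - T * (V n).starProjection) x
      = -(T y - (V n).starProjection (T y)) := by
    rw [neg_sub, ← h1]
    rfl
  rw [h2, norm_neg, mul_comm]
  refine (hin n y hyV).trans ?_
  gcongr
  exact (V n).norm_starProjection_apply_le x

include hι hιs hι1 hp hSM in
-- S leaves W M invariant and p kills W M, so p S ι p = p S on M; the inner projections in a power
-- of the compression can be dropped.
theorem compression_shift_pow (hWM : ∀ x ∈ M, W x ∈ M) (hSW : ∀ x, S (W x) = W (S x)) (k : ℕ) :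
    (p ∘L S.toContinuousLinearMap ∘L ι) ^ k = p ∘L (S.toContinuousLinearMap ^ k) ∘L ι := by
  have hker : ∀ y ∈ M, p (W y) = 0 := fun y hy => ext_inner_left ℂ fun x => by
    rw [hp, inner_zero_right]
    exact inner_eq_zero_symm.1 ((mem_isometryModel.1 (hι x)).2 y hy)
  have hpS : ∀ x ∈ M, p (S (ι (p x))) = p (S x) := by
    intro x hx
    obtain ⟨g, hg, h, hh, rfl⟩ := exists_isometryModel_add hWM hx
    obtain ⟨z, rfl⟩ := hιs g hg
    rw [map_add, hker h hh, add_zero, proj_embedding hι1 hp, map_add, map_add, hSW,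
      hker _ (hSM h hh), add_zero]
  have hpow : ∀ (k : ℕ), ∀ x ∈ M, (S.toContinuousLinearMap ^ k) x ∈ M := by
    intro k
    induction k with
    | zero => exact fun x hx => hx
    | succ k ih =>
      intro x hx
      rw [pow_succ']
      exact hSM _ (ih x hx)
  induction k with
  | zero =>
    ext x
    exact (proj_embedding hι1 hp x).symm
  | succ k ih =>
    ext x
    rw [pow_succ', ih, pow_succ']
    exact hpS _ (hpow k _ (mem_isometryModel.1 (hι x)).1)

end Limit

end IsometryModel

/-! ## Multiplication operators on `L²` of the circle -/

section Multiplication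

theorem coeFn_mulOp (a : Lp ℂ ∞ (haarAddCircle (T := (1 : ℝ)))) (f : L2Circle) :
    mulOp a f =ᵐ[haarAddCircle] fun t => a t * f t :=
  (ContinuousLinearMap.mul ℂ ℂ).coeFn_holder a f

theorem mulOp_comm (a b : Lp ℂ ∞ (haarAddCircle (T := (1 : ℝ)))) (f : L2Circle) :
    mulOp a (mulOp b f) = mulOp b (mulOp a f) := by
  refine Lp.ext ?_
  filter_upwards [coeFn_mulOp a (mulOp b f), coeFn_mulOp b (mulOp a f), coeFn_mulOp a f,
    coeFn_mulOp b f] with t h1 h2 h3 h4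
  rw [h1, h2, h3, h4, mul_left_comm]

/-- Multiplication by a unimodular function, as an isometry of `L²`. -/
def unimodularMul (a : Lp ℂ ∞ (haarAddCircle (T := (1 : ℝ))))
    (ha : ∀ᵐ t ∂haarAddCircle, ‖a t‖ = 1) : L2Circle →ₗᵢ[ℂ] L2Circle where
  toLinearMap := mulOp a
  norm_map' f := by
    change ‖mulOp a f‖ = ‖f‖
    refine le_antisymm (Lp.norm_le_norm_of_ae_le ?_) (Lp.norm_le_norm_of_ae_le ?_) <;>
    · filter_upwards [coeFn_mulOp a f, ha] with t h1 h2
      rw [h1, norm_mul, h2, one_mul]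

theorem unimodularMul_apply (a : Lp ℂ ∞ (haarAddCircle (T := (1 : ℝ))))
    (ha : ∀ᵐ t ∂haarAddCircle, ‖a t‖ = 1) (f : L2Circle) : unimodularMul a ha f = mulOp a f :=
  rfl

theorem unimodularMul_surjective (a : Lp ℂ ∞ (haarAddCircle (T := (1 : ℝ))))
    (ha : ∀ᵐ t ∂haarAddCircle, ‖a t‖ = 1) : Function.Surjective (unimodularMul a ha) := by
  intro f
  refine ⟨mulOp (star a) f, Lp.ext ?_⟩
  rw [unimodularMul_apply]
  filter_upwards [coeFn_mulOp a (mulOp (star a) f), coeFn_mulOp (star a) f, Lp.coeFn_star a, ha]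
    with t h1 h2 h3 h4
  rw [h1, h2, h3, Pi.star_apply, ← mul_assoc, Complex.star_def, Complex.mul_conj,
    Complex.normSq_eq_norm_sq, h4]
  simp

/-- `u H²` is the image of `H²` under the multiplication by `u`. -/
theorem mulHardySpace_eq_map (u : L2Circle) (a : Lp ℂ ∞ (haarAddCircle (T := (1 : ℝ))))
    (ha : ∀ᵐ t ∂haarAddCircle, ‖a t‖ = 1) (hu : u =ᵐ[haarAddCircle] a) :
    mulHardySpace u = hardySpace.map (unimodularMul a ha).toLinearMap := by
  ext g
  constructor
  · rintro ⟨f, hf, h⟩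
    refine ⟨f, hf, ?_⟩
    change mulOp a f = g
    refine Lp.ext ?_
    filter_upwards [h, hu, coeFn_mulOp a f] with t h1 h2 h3
    rw [h1, h2, h3]
  · rintro ⟨f, hf, rfl⟩
    refine ⟨f, hf, ?_⟩
    change mulOp a f =ᵐ[haarAddCircle] _
    filter_upwards [hu, coeFn_mulOp a f] with t h2 h3
    rw [h2, h3]

/-- Multiplication by a continuous function, as an operator on `L²`. -/
def mulCont : C(AddCircle (1 : ℝ), ℂ) →L[ℂ] L2Circle →L[ℂ] L2Circle :=
  ((ContinuousLinearMap.mul ℂ ℂ).holderL haarAddCircle ∞ 2 2) ∘L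
    ContinuousMap.toLp ∞ haarAddCircle ℂ

theorem mulCont_eq (g : C(AddCircle (1 : ℝ), ℂ)) :
    mulCont g = mulOp (ContinuousMap.toLp ∞ haarAddCircle ℂ g) := rfl

theorem coeFn_mulCont (g : C(AddCircle (1 : ℝ), ℂ)) (f : L2Circle) :
    mulCont g f =ᵐ[haarAddCircle] fun t => g t * f t := by
  rw [mulCont_eq]
  filter_upwards [coeFn_mulOp (ContinuousMap.toLp ∞ haarAddCircle ℂ g) f,
    ContinuousMap.coeFn_toLp (p := ∞) (𝕜 := ℂ) haarAddCircle g] with t h1 h2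
  rw [h1, h2]

theorem mulCont_mul (g h : C(AddCircle (1 : ℝ), ℂ)) : mulCont (g * h) = mulCont g * mulCont h := by
  ext1 f
  refine Lp.ext ?_
  filter_upwards [coeFn_mulCont (g * h) f, coeFn_mulCont g (mulCont h f), coeFn_mulCont h f]
    with t h1 h2 h3
  rw [h1, mul_apply_eq_comp, h2, h3, ContinuousMap.mul_apply, mul_assoc]

theorem mulCont_one : mulCont 1 = 1 := by
  ext1 f
  refine Lp.ext ?_
  filter_upwards [coeFn_mulCont 1 f] with t h1
  rw [h1, ContinuousMap.one_apply, one_mul]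
  rfl

theorem mulCont_pow (g : C(AddCircle (1 : ℝ), ℂ)) (k : ℕ) : mulCont (g ^ k) = mulCont g ^ k := by
  induction k with
  | zero => rw [pow_zero, pow_zero, mulCont_one]
  | succ k ih => rw [pow_succ, pow_succ, mulCont_mul, ih]

theorem mulCont_toLp (g h : C(AddCircle (1 : ℝ), ℂ)) :
    mulCont g (ContinuousMap.toLp 2 haarAddCircle ℂ h)
      = ContinuousMap.toLp 2 haarAddCircle ℂ (g * h) := by
  refine Lp.ext ?_
  filter_upwards [coeFn_mulCont g (ContinuousMap.toLp 2 haarAddCircle ℂ h),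
    ContinuousMap.coeFn_toLp (p := 2) (𝕜 := ℂ) haarAddCircle h,
    ContinuousMap.coeFn_toLp (p := 2) (𝕜 := ℂ) haarAddCircle (g * h)] with t h1 h2 h3
  rw [h1, h2, h3, ContinuousMap.mul_apply]

theorem inner_mulCont_left (g : C(AddCircle (1 : ℝ), ℂ)) (f h : L2Circle) :
    inner ℂ (mulCont g f) h = inner ℂ f (mulCont (star g) h) := by
  rw [L2.inner_def, L2.inner_def]
  refine integral_congr_ae ?_
  filter_upwards [coeFn_mulCont g f, coeFn_mulCont (star g) h] with t h1 h2
  rw [h1, h2, RCLike.inner_apply, RCLike.inner_apply, map_mul, ContinuousMap.star_apply]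
  simp only [RCLike.star_def]
  ring

/-- Multiplication by a continuous unimodular function, as an isometry of `L²`. -/
def unimodularMulCont (g : C(AddCircle (1 : ℝ), ℂ)) (hg : ∀ t, ‖g t‖ = 1) :
    L2Circle →ₗᵢ[ℂ] L2Circle :=
  unimodularMul (ContinuousMap.toLp ∞ haarAddCircle ℂ g) (by
    filter_upwards [ContinuousMap.coeFn_toLp (p := ∞) (𝕜 := ℂ) haarAddCircle g] with t h
    rw [h, hg])

theorem mulHardySpace_toLp_eq_map (g : C(AddCircle (1 : ℝ), ℂ)) (hg : ∀ t, ‖g t‖ = 1) :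
    mulHardySpace (ContinuousMap.toLp 2 haarAddCircle ℂ g : L2Circle)
      = hardySpace.map (unimodularMulCont g hg).toLinearMap := by
  refine mulHardySpace_eq_map _ _ _ ?_
  filter_upwards [ContinuousMap.coeFn_toLp (p := ∞) (𝕜 := ℂ) haarAddCircle g,
    ContinuousMap.coeFn_toLp (p := 2) (𝕜 := ℂ) haarAddCircle g] with t h1 h2
  rw [h1, h2]

end Multiplication

/-! ## The shift on the Hardy space -/

section Hardy

instance : CompleteSpace hardySpace := isClosed_hardySpace.completeSpace_coe

theorem mem_hardySpace {f : L2Circle} :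
    f ∈ hardySpace ↔ ∀ n : ℤ, n < 0 → inner ℂ (fourierLp 2 n) f = 0 := by
  refine forall₂_congr fun n _ => ?_
  rw [← coe_fourierBasis, ← HilbertBasis.repr_apply_apply]

theorem eq_zero_of_inner_fourierLp {f : L2Circle}
    (h : ∀ n : ℤ, inner ℂ (fourierLp 2 n) f = 0) : f = 0 := by
  have h1 : fourierBasis.repr f = 0 := by
    ext n
    rw [HilbertBasis.repr_apply_apply, coe_fourierBasis, h]
    rfl
  simpa using h1

theorem norm_fourierLp (n : ℤ) : ‖(fourierLp 2 n : L2Circle)‖ = 1 := orthonormal_fourier.1 n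

theorem inner_fourierLp_of_ne {m n : ℤ} (h : m ≠ n) :
    inner ℂ (fourierLp 2 m : L2Circle) (fourierLp 2 n) = 0 := orthonormal_fourier.2 h

theorem inner_fourierLp_self (n : ℤ) :
    inner ℂ (fourierLp 2 n : L2Circle) (fourierLp 2 n) = 1 := by
  rw [inner_self_eq_norm_sq_to_K, norm_fourierLp]
  simp

theorem fourierLp_mem_hardySpace (n : ℕ) : (fourierLp 2 (n : ℤ) : L2Circle) ∈ hardySpace :=
  mem_hardySpace.2 fun m hm => inner_fourierLp_of_ne (by omega)

theorem fourier_mul_fourier (m n : ℤ) :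
    (fourier m * fourier n : C(AddCircle (1 : ℝ), ℂ)) = fourier (m + n) := by
  ext t
  rw [ContinuousMap.mul_apply, fourier_add]

theorem star_fourier (n : ℤ) : star (fourier n : C(AddCircle (1 : ℝ), ℂ)) = fourier (-n) := by
  ext t
  rw [ContinuousMap.star_apply, fourier_neg]
  rfl

theorem mulCont_fourier_fourierLp (m n : ℤ) :
    mulCont (fourier m) (fourierLp 2 n) = fourierLp 2 (m + n) := by
  rw [fourierLp, mulCont_toLp, fourier_mul_fourier]

theorem inner_fourierLp_mulCont (m n : ℤ) (f : L2Circle) :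
    inner ℂ (fourierLp 2 m) (mulCont (fourier n) f) = inner ℂ (fourierLp 2 (m - n)) f := by
  have h : (fourier n : C(AddCircle (1 : ℝ), ℂ)) = star (fourier (-n)) := by
    rw [star_fourier, neg_neg]
  rw [h, ← inner_mulCont_left, mulCont_fourier_fourierLp, neg_add_eq_sub]

theorem mulCont_fourier_mem_hardySpace (n : ℕ) {f : L2Circle} (hf : f ∈ hardySpace) :
    mulCont (fourier n) f ∈ hardySpace :=
  mem_hardySpace.2 fun m hm => by
    rw [inner_fourierLp_mulCont]
    exact mem_hardySpace.1 hf _ (by omega)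

theorem norm_fourier_apply (n : ℤ) (t : AddCircle (1 : ℝ)) :
    ‖(fourier n : C(AddCircle (1 : ℝ), ℂ)) t‖ = 1 := by
  rw [fourier_apply]
  exact Circle.norm_coe _

/-- Multiplication by the independent variable on `L²`. -/
def bilateralShift : L2Circle →ₗᵢ[ℂ] L2Circle := unimodularMulCont (fourier 1) (norm_fourier_apply 1)

theorem bilateralShift_mem_hardySpace {f : L2Circle} (hf : f ∈ hardySpace) :
    bilateralShift f ∈ hardySpace := mulCont_fourier_mem_hardySpace 1 hf

/-- Negative Fourier coefficients vanish on H²; positive ones vanish because t^(1+k) is the shift of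
t^k. -/
theorem isometryModel_bilateralShift_le :
    isometryModel hardySpace bilateralShift ≤ Submodule.span ℂ {fourierLp 2 0} := by
  intro x hx
  rw [mem_isometryModel] at hx
  refine Submodule.mem_span_singleton.2 ⟨inner ℂ (fourierLp 2 0) x, ?_⟩
  refine (sub_eq_zero.1 (eq_zero_of_inner_fourierLp fun n => ?_)).symm
  rw [inner_sub_right, inner_smul_right]
  obtain hn | rfl | hn := lt_trichotomy n 0
  · rw [mem_hardySpace.1 hx.1 n hn, inner_fourierLp_of_ne hn.ne, mul_zero, sub_zero]
  · rw [inner_fourierLp_self, mul_one, sub_self]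
  · rw [inner_fourierLp_of_ne hn.ne', mul_zero, sub_zero]
    obtain ⟨k, rfl⟩ : ∃ k : ℕ, n = 1 + k := ⟨(n - 1).toNat, by omega⟩
    rw [← mulCont_fourier_fourierLp]
    exact hx.2 _ (fourierLp_mem_hardySpace k)

end Hardy

/-! ## Boundary functions of functions analytic across the circle -/

section BoundaryAnalytic

variable {f : ℂ → ℂ} {R : ℝ} (hR : 1 < R) (hf : DifferentiableOn ℂ f (Metric.ball 0 R))
  {g : C(AddCircle (1 : ℝ), ℂ)} (hg : ∀ t, g t = f (fourier 1 t))

include hR hf hg in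
-- The Taylor series converges absolutely at some radius r > 1, hence uniformly on the circle.
theorem hasSum_taylor_fourier :
    HasSum (fun n : ℕ => (iteratedDeriv n f 0 / (n.factorial : ℂ)) •
      (fourier (n : ℤ) : C(AddCircle (1 : ℝ), ℂ))) g := by
  have hsum : ∀ z : ℂ, ‖z‖ < R →
      HasSum (fun n : ℕ => iteratedDeriv n f 0 / (n.factorial : ℂ) * z ^ n) (f z) := by
    intro z hz
    refine (Complex.hasSum_taylorSeries_on_ball hf (by simpa using hz)).congr_fun ?_
    intro n
    simp only [smul_eq_mul, sub_zero]
    ring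
  obtain ⟨r, hr1, hrR⟩ := exists_between hR
  have hs : Summable fun n : ℕ => (iteratedDeriv n f 0 / (n.factorial : ℂ)) •
      (fourier (n : ℤ) : C(AddCircle (1 : ℝ), ℂ)) := by
    refine Summable.of_norm_bounded ((hsum r (by
      rwa [Complex.norm_real, Real.norm_of_nonneg (by linarith)])).summable.norm) fun n => ?_
    rw [norm_smul, fourier_norm, mul_one, norm_mul, norm_pow, Complex.norm_real,
      Real.norm_of_nonneg (by linarith)]
    exact le_mul_of_one_le_right (norm_nonneg _) (one_le_pow₀ hr1.le)
  have h : ∑' n : ℕ, (iteratedDeriv n f 0 / (n.factorial : ℂ)) •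
      (fourier (n : ℤ) : C(AddCircle (1 : ℝ), ℂ)) = g := by
    ext t
    have h1 := (ContinuousMap.evalCLM ℂ t).hasSum hs.hasSum
    refine h1.unique ?_
    rw [hg t]
    refine (hsum (fourier 1 t) (by rw [norm_fourier_apply]; exact hR)).congr_fun fun n => ?_
    simp [fourier_apply, AddCircle.toCircle_nsmul]
  rw [← h]
  exact hs.hasSum

include hR hf hg in
theorem hasSum_taylor_fourierLp :
    HasSum (fun n : ℕ => (iteratedDeriv n f 0 / (n.factorial : ℂ)) •
      (fourierLp 2 (n : ℤ) : L2Circle)) (ContinuousMap.toLp 2 haarAddCircle ℂ g) := by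
  have h := (ContinuousMap.toLp 2 (haarAddCircle (T := (1 : ℝ))) ℂ).hasSum
    (hasSum_taylor_fourier hR hf hg)
  simpa using h

include hR hf hg in
theorem boundaryFunction_eq_toLp : boundaryFunction f = ContinuousMap.toLp 2 haarAddCircle ℂ g :=
  (hasSum_taylor_fourierLp hR hf hg).tsum_eq

include hR hf hg in
theorem inner_fourierLp_toLp (n : ℕ) :
    inner ℂ (fourierLp 2 (n : ℤ)) (ContinuousMap.toLp 2 haarAddCircle ℂ g : L2Circle)
      = iteratedDeriv n f 0 / (n.factorial : ℂ) := by
  have h := (innerSL ℂ (fourierLp 2 (n : ℤ) : L2Circle)).hasSum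
    (hasSum_taylor_fourierLp hR hf hg)
  have hz : ∀ m : ℕ, m ≠ n → innerSL ℂ (fourierLp 2 (n : ℤ) : L2Circle)
      ((iteratedDeriv m f 0 / (m.factorial : ℂ)) • fourierLp 2 (m : ℤ)) = 0 := fun m hm => by
    rw [innerSL_apply_apply, inner_smul_right, inner_fourierLp_of_ne (by omega), mul_zero]
  refine (h.unique (hasSum_single n hz)).trans ?_
  rw [innerSL_apply_apply, inner_smul_right, inner_fourierLp_self, mul_one]

include hR hf hg in
-- By uniform convergence of the Taylor series, g x is a limit of combinations of t^n x with n ≥ 0,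
-- and H² is closed.
theorem mulCont_mem_hardySpace {x : L2Circle} (hx : x ∈ hardySpace) :
    mulCont g x ∈ hardySpace := by
  have h := (mulCont.flip x).hasSum (hasSum_taylor_fourier hR hf hg)
  refine isClosed_hardySpace.mem_of_tendsto h (Eventually.of_forall fun s => ?_)
  refine Submodule.sum_mem _ fun n _ => ?_
  simp only [ContinuousLinearMap.flip_apply, map_smul]
  exact Submodule.smul_mem _ _ (mulCont_fourier_mem_hardySpace n hx)

end BoundaryAnalytic

/-! ## Blaschke factors -/

section Factor

variable {μ z : ℂ}

theorem one_sub_conj_mul_ne_zero (h : ‖μ‖ * ‖z‖ < 1) : 1 - conj μ * z ≠ 0 := by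
  intro h0
  have h1 : ‖conj μ * z‖ = 1 := by rw [← sub_eq_zero.1 h0, norm_one]
  rw [norm_mul, RCLike.norm_conj] at h1
  linarith

theorem differentiableOn_blaschkeFactor {R : ℝ} (hR : ‖μ‖ * R ≤ 1) :
    DifferentiableOn ℂ (blaschkeFactor μ) (Metric.ball 0 R) := by
  by_cases hμ : μ = 0
  · have : blaschkeFactor μ = id := by
      ext z
      simp [blaschkeFactor, hμ]
    rw [this]
    exact differentiableOn_id
  · have : blaschkeFactor μ = fun z => (μ - z) / (1 - conj μ * z) * ((‖μ‖ : ℂ) / μ) := by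
      ext z
      simp [blaschkeFactor, hμ]
    rw [this]
    refine DifferentiableOn.mul_const (DifferentiableOn.div (by fun_prop) (by fun_prop)
      fun z hz => one_sub_conj_mul_ne_zero ?_) _
    rw [mem_ball_zero_iff] at hz
    have := norm_pos_iff.2 hμ
    nlinarith

theorem norm_blaschkeFactor (hμ : ‖μ‖ < 1) (hz : ‖z‖ = 1) : ‖blaschkeFactor μ z‖ = 1 := by
  unfold blaschkeFactor
  split_ifs with h
  · exact hz
  · have h0 := norm_pos_iff.2 (one_sub_conj_mul_ne_zero (μ := μ) (z := z) (by rwa [hz, mul_one]))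
    have h1 : ‖μ - z‖ = ‖1 - conj μ * z‖ := by
      -- Uses |z| = 1: multiplying by z turns the conjugate of the numerator into minus the
      -- denominator.
      have e : conj (μ - z) * z = -(1 - conj μ * z) := by
        have e1 : conj z * z = 1 := by
          rw [mul_comm, Complex.mul_conj, Complex.normSq_eq_norm_sq, hz]
          simp
        rw [map_sub, sub_mul, e1]
        ring
      rw [← norm_neg (1 - conj μ * z), ← e, norm_mul, hz, mul_one, RCLike.norm_conj]
    rw [norm_mul, norm_div, norm_div, h1, div_self h0.ne', Complex.norm_real, norm_norm,
      div_self (norm_ne_zero_iff.2 h), one_mul]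

theorem blaschkeFactor_zero_right : blaschkeFactor μ 0 = ‖μ‖ := by
  unfold blaschkeFactor
  split_ifs with h
  · simp [h]
  · simp [mul_div_cancel₀ _ h]

/-- For fixed z the distance of b_μ(z) from 1 is of order 1 - |μ|, which makes the infinite product
converge under the Blaschke condition. -/
theorem norm_one_sub_blaschkeFactor_le (hμ : ‖μ‖ < 1) (hz : ‖z‖ < 1) :
    ‖blaschkeFactor μ z - 1‖ ≤ (1 + ‖z‖) / (1 - ‖z‖) * (1 - ‖μ‖) := by
  have hz0 := norm_nonneg z
  have hz1 : 0 < 1 - ‖z‖ := by linarith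
  unfold blaschkeFactor
  split_ifs with h
  · rw [h, norm_zero, sub_zero, mul_one]
    refine (norm_sub_le _ _).trans ?_
    rw [norm_one, le_div_iff₀ hz1]
    nlinarith
  · have h0 := norm_pos_iff.2 h
    have hne := one_sub_conj_mul_ne_zero (μ := μ) (z := z) (by nlinarith)
    have e : (μ - z) / (1 - conj μ * z) * ((‖μ‖ : ℂ) / μ) - 1
        = -((1 - (‖μ‖ : ℂ)) * (μ + z * ‖μ‖)) / ((1 - conj μ * z) * μ) := by
      have hc : conj μ * μ = (‖μ‖ : ℂ) ^ 2 := by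
        rw [mul_comm, Complex.mul_conj, Complex.normSq_eq_norm_sq]
        push_cast
        rfl
      rw [div_mul_div_comm, div_sub_one (mul_ne_zero hne h)]
      congr 1
      linear_combination z * hc
    have h1 : ‖(1 : ℂ) - ‖μ‖‖ = 1 - ‖μ‖ := by
      rw [← Complex.ofReal_one, ← Complex.ofReal_sub, Complex.norm_real,
        Real.norm_of_nonneg (by linarith)]
    have h2 : ‖μ + z * ‖μ‖‖ ≤ ‖μ‖ * (1 + ‖z‖) := by
      refine (norm_add_le _ _).trans ?_
      rw [norm_mul, Complex.norm_real, norm_norm]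
      linarith
    have h3 : 1 - ‖z‖ ≤ ‖1 - conj μ * z‖ := by
      have := norm_sub_norm_le (1 : ℂ) (conj μ * z)
      rw [norm_one, norm_mul, RCLike.norm_conj] at this
      nlinarith
    rw [e, norm_div, norm_neg, norm_mul, norm_mul, h1, div_mul_eq_mul_div,
      div_le_div_iff₀ (mul_pos (hz1.trans_le h3) h0) hz1]
    calc (1 - ‖μ‖) * ‖μ + z * ‖μ‖‖ * (1 - ‖z‖)
        ≤ (1 - ‖μ‖) * (‖μ‖ * (1 + ‖z‖)) * ‖1 - conj μ * z‖ := by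
          gcongr
      _ = (1 + ‖z‖) * (1 - ‖μ‖) * (‖1 - conj μ * z‖ * ‖μ‖) := by ring

/-- `b_μ (1 - μ̄ z) c = μ - z` for some constant `c`. -/
theorem exists_blaschkeFactor_mul (μ : ℂ) : ∃ c : ℂ, ∀ z : ℂ, 1 - conj μ * z ≠ 0 →
    blaschkeFactor μ z * (c * (1 - conj μ * z)) = μ - z := by
  by_cases h : μ = 0
  · exact ⟨-1, fun z _ => by simp [blaschkeFactor, h]⟩
  · refine ⟨μ / ‖μ‖, fun z hz => ?_⟩
    have h0 : (‖μ‖ : ℂ) ≠ 0 := by simpa using h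
    rw [blaschkeFactor, if_neg h]
    calc _ = (μ - z) * ((1 - conj μ * z) / (1 - conj μ * z)) * ((‖μ‖ : ℂ) / ‖μ‖) * (μ / μ) := by
          ring
      _ = μ - z := by rw [div_self hz, div_self h0, div_self h, mul_one, mul_one, mul_one]

end Factor

/-! ## Finite Blaschke products on the circle -/

section Finite

variable {lam : ℕ → ℂ} (hdisk : ∀ k, ‖lam k‖ < 1)

include hdisk in
theorem exists_one_lt_forall_norm_mul_le (s : Finset ℕ) :
    ∃ R : ℝ, 1 < R ∧ ∀ k ∈ s, ‖lam k‖ * R ≤ 1 := by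
  have h : ∀ᶠ R : ℝ in 𝓝[>] 1, ∀ k ∈ s, ‖lam k‖ * R ≤ 1 := by
    refine (Finset.eventually_all s).2 fun k _ => ?_
    have h1 : Tendsto (fun R : ℝ => ‖lam k‖ * R) (𝓝[>] 1) (𝓝 (‖lam k‖ * 1)) :=
      ((continuous_const.mul continuous_id).tendsto 1).mono_left nhdsWithin_le_nhds
    rw [mul_one] at h1
    exact (h1.eventually_lt_const (hdisk k)).mono fun R hR => hR.le
  obtain ⟨R, h1, h2⟩ := (h.and self_mem_nhdsWithin).exists
  exact ⟨R, h2, h1⟩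

theorem differentiableOn_prod_blaschkeFactor {s : Finset ℕ} {R : ℝ}
    (hR : ∀ k ∈ s, ‖lam k‖ * R ≤ 1) :
    DifferentiableOn ℂ (fun z => ∏ k ∈ s, blaschkeFactor (lam k) z) (Metric.ball 0 R) :=
  DifferentiableOn.fun_finsetProd fun k hk => differentiableOn_blaschkeFactor (hR k hk)

/-- The restriction of a finite Blaschke product to the circle. -/
def circleBlaschke (s : Finset ℕ) : C(AddCircle (1 : ℝ), ℂ) where
  toFun t := ∏ k ∈ s, blaschkeFactor (lam k) (fourier 1 t)
  continuous_toFun := by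
    obtain ⟨R, hR1, hR⟩ := exists_one_lt_forall_norm_mul_le hdisk s
    exact (differentiableOn_prod_blaschkeFactor hR).continuousOn.comp_continuous
      (ContinuousMap.continuous _) fun t => by
        rw [mem_ball_zero_iff, norm_fourier_apply]
        exact hR1

theorem circleBlaschke_apply (s : Finset ℕ) (t : AddCircle (1 : ℝ)) :
    circleBlaschke hdisk s t = ∏ k ∈ s, blaschkeFactor (lam k) (fourier 1 t) := rfl

theorem norm_circleBlaschke (s : Finset ℕ) (t : AddCircle (1 : ℝ)) :
    ‖circleBlaschke hdisk s t‖ = 1 := by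
  rw [circleBlaschke_apply, norm_prod]
  exact Finset.prod_eq_one fun k _ => norm_blaschkeFactor (hdisk k) (norm_fourier_apply 1 t)

theorem circleBlaschke_mul {s t : Finset ℕ} (h : Disjoint s t) :
    circleBlaschke hdisk s * circleBlaschke hdisk t = circleBlaschke hdisk (s ∪ t) := by
  ext x
  simp [circleBlaschke_apply, Finset.prod_union h]

/-- Multiplication by a finite Blaschke product. -/
def mulBlaschke (s : Finset ℕ) : L2Circle →ₗᵢ[ℂ] L2Circle :=
  unimodularMulCont (circleBlaschke hdisk s) (norm_circleBlaschke hdisk s)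

theorem mulBlaschke_apply (s : Finset ℕ) (f : L2Circle) :
    mulBlaschke hdisk s f = mulCont (circleBlaschke hdisk s) f := rfl

theorem mulBlaschke_mem_hardySpace (s : Finset ℕ) {f : L2Circle} (hf : f ∈ hardySpace) :
    mulBlaschke hdisk s f ∈ hardySpace := by
  obtain ⟨R, hR1, hR⟩ := exists_one_lt_forall_norm_mul_le hdisk s
  exact mulCont_mem_hardySpace hR1 (differentiableOn_prod_blaschkeFactor hR)
    (circleBlaschke_apply hdisk s) hf

theorem mulBlaschke_mulBlaschke {s t : Finset ℕ} (h : Disjoint s t) (f : L2Circle) :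
    mulBlaschke hdisk s (mulBlaschke hdisk t f) = mulBlaschke hdisk (s ∪ t) f := by
  simp only [mulBlaschke_apply]
  rw [← circleBlaschke_mul hdisk h, mulCont_mul, mul_apply_eq_comp]

theorem mulBlaschke_range_mulBlaschke_Ico {m n : ℕ} (h : m ≤ n) (f : L2Circle) :
    mulBlaschke hdisk (Finset.range m) (mulBlaschke hdisk (Finset.Ico m n) f)
      = mulBlaschke hdisk (Finset.range n) f := by
  rw [Finset.range_eq_Ico, mulBlaschke_mulBlaschke hdisk
    (Finset.Ico_disjoint_Ico_consecutive 0 m n), Finset.Ico_union_Ico_eq_Ico (Nat.zero_le m) h,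
    Finset.range_eq_Ico]

theorem mulBlaschke_fourierLp_zero (s : Finset ℕ) :
    mulBlaschke hdisk s (fourierLp 2 0)
      = ContinuousMap.toLp 2 haarAddCircle ℂ (circleBlaschke hdisk s) := by
  rw [mulBlaschke_apply, fourierLp, mulCont_toLp]
  congr 1
  ext t
  simp

theorem modelSpace_partialBlaschke (n : ℕ) : modelSpace (partialBlaschke lam n)
    = isometryModel hardySpace (mulBlaschke hdisk (Finset.range n)) := by
  obtain ⟨R, hR1, hR⟩ := exists_one_lt_forall_norm_mul_le hdisk (Finset.range n)
  have h : boundaryFunction (partialBlaschke lam n)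
      = ContinuousMap.toLp 2 haarAddCircle ℂ (circleBlaschke hdisk (Finset.range n)) :=
    boundaryFunction_eq_toLp hR1 (differentiableOn_prod_blaschkeFactor hR)
      (circleBlaschke_apply hdisk _)
  rw [modelSpace, h, mulHardySpace_toLp_eq_map _ (norm_circleBlaschke hdisk _)]
  rfl

theorem antitone_map_mulBlaschke_range :
    Antitone fun n => hardySpace.map (mulBlaschke hdisk (Finset.range n)).toLinearMap := by
  rintro m n hmn _ ⟨f, hf, rfl⟩
  exact ⟨_, mulBlaschke_mem_hardySpace hdisk (Finset.Ico m n) hf,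
    mulBlaschke_range_mulBlaschke_Ico hdisk hmn f⟩

/-- Since (λ - z) z^n is b_λ times a function in H², it is orthogonal to the model space. This is a
recursion for Fourier coefficients, x̂(n+1) = conj(λ) x̂(n), so x is determined by x̂(0). -/
theorem finiteDimensional_isometryModel_mulBlaschke_singleton (k : ℕ) :
    FiniteDimensional ℂ (isometryModel hardySpace (mulBlaschke hdisk {k})) := by
  obtain ⟨c, hc⟩ := exists_blaschkeFactor_mul (lam k)
  have hrec : ∀ x ∈ isometryModel hardySpace (mulBlaschke hdisk {k}), ∀ n : ℕ,
      inner ℂ (fourierLp 2 ((n + 1 : ℕ) : ℤ)) x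
        = conj (lam k) * inner ℂ (fourierLp 2 (n : ℤ)) x := by
    intro x hx n
    have h1 : mulBlaschke hdisk {k} (c • (fourierLp 2 (n : ℤ)
        - conj (lam k) • fourierLp 2 ((n + 1 : ℕ) : ℤ)))
        = lam k • fourierLp 2 (n : ℤ) - fourierLp 2 ((n + 1 : ℕ) : ℤ) := by
      have e1 : (c • (fourierLp 2 (n : ℤ) - conj (lam k) • fourierLp 2 ((n + 1 : ℕ) : ℤ))
          : L2Circle) = ContinuousMap.toLp 2 haarAddCircle ℂ
            (c • (fourier (n : ℤ) - conj (lam k) • fourier ((n + 1 : ℕ) : ℤ))) := by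
        simp only [map_smul, map_sub]
      have e2 : (lam k • fourierLp 2 (n : ℤ) - fourierLp 2 ((n + 1 : ℕ) : ℤ) : L2Circle)
          = ContinuousMap.toLp 2 haarAddCircle ℂ
            (lam k • fourier (n : ℤ) - fourier ((n + 1 : ℕ) : ℤ)) := by
        simp only [map_smul, map_sub]
      rw [e1, e2, mulBlaschke_apply, mulCont_toLp]
      congr 1
      ext t
      have h2 := hc (fourier 1 t) (one_sub_conj_mul_ne_zero (by
        rw [norm_fourier_apply, mul_one]
        exact hdisk k))
      have h3 : (fourier ((n + 1 : ℕ) : ℤ) : C(AddCircle (1 : ℝ), ℂ)) t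
          = fourier (n : ℤ) t * fourier 1 t := by
        push_cast
        rw [fourier_add]
      simp only [ContinuousMap.mul_apply, ContinuousMap.smul_apply, ContinuousMap.sub_apply, h3,
        smul_eq_mul, circleBlaschke_apply, Finset.prod_singleton]
      linear_combination (fourier (n : ℤ) t) * h2
    have h4 := (mem_isometryModel.1 hx).2 (c • (fourierLp 2 (n : ℤ)
        - conj (lam k) • fourierLp 2 ((n + 1 : ℕ) : ℤ)))
      (Submodule.smul_mem _ _ (Submodule.sub_mem _ (fourierLp_mem_hardySpace n)
        (Submodule.smul_mem _ _ (fourierLp_mem_hardySpace (n + 1)))))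
    rw [h1, inner_sub_left, inner_smul_left] at h4
    exact (sub_eq_zero.1 h4).symm
  refine FiniteDimensional.of_injective ((innerSL ℂ (fourierLp 2 0 : L2Circle)).toLinearMap ∘ₗ
    (isometryModel hardySpace (mulBlaschke hdisk {k})).subtype)
    ((injective_iff_map_eq_zero _).2 fun x hx => ?_)
  have h0 : inner ℂ (fourierLp 2 0 : L2Circle) (x : L2Circle) = 0 := hx
  have hn : ∀ n : ℕ, inner ℂ (fourierLp 2 (n : ℤ) : L2Circle) (x : L2Circle) = 0 := by
    intro n
    induction n with
    | zero => exact h0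
    | succ n ih => rw [hrec _ x.2, ih, mul_zero]
  refine Subtype.ext (eq_zero_of_inner_fourierLp fun n => ?_)
  obtain hneg | hneg := lt_or_ge n 0
  · exact mem_hardySpace.1 (mem_isometryModel.1 x.2).1 n hneg
  · obtain ⟨m, rfl⟩ := Int.eq_ofNat_of_zero_le hneg
    exact hn m

theorem finiteDimensional_isometryModel_mulBlaschke_range (n : ℕ) :
    FiniteDimensional ℂ (isometryModel hardySpace (mulBlaschke hdisk (Finset.range n))) := by
  induction n with
  | zero =>
    have h : isometryModel hardySpace (mulBlaschke hdisk (Finset.range 0)) = ⊥ := by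
      refine (Submodule.eq_bot_iff _).2 fun x hx => ?_
      rw [mem_isometryModel] at hx
      have h1 : circleBlaschke hdisk (Finset.range 0) = 1 := by
        ext t
        simp [circleBlaschke_apply]
      have h2 := hx.2 x hx.1
      rw [mulBlaschke_apply, h1, mulCont_one] at h2
      exact inner_self_eq_zero.1 h2
    rw [h]
    infer_instance
  | succ n ih =>
    have := finiteDimensional_isometryModel_mulBlaschke_singleton hdisk n
    have h : mulBlaschke hdisk (Finset.range (n + 1))
        = (mulBlaschke hdisk (Finset.range n)).comp (mulBlaschke hdisk {n}) := by
      ext1 f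
      refine Eq.trans ?_ (mulBlaschke_mulBlaschke hdisk (by simp) f).symm
      rw [Finset.range_add_one, Finset.insert_eq, Finset.union_comm]
    rw [h]
    exact finiteDimensional_isometryModel_comp
      (fun x hx => mulBlaschke_mem_hardySpace hdisk _ hx)
      fun x hx => mulBlaschke_mem_hardySpace hdisk _ hx

/-- The mean over the circle is the value at 0, and the normalization of the factors makes b_μ(0) =
|μ|. -/
theorem inner_fourierLp_zero_mulBlaschke (s : Finset ℕ) :
    inner ℂ (fourierLp 2 0) (mulBlaschke hdisk s (fourierLp 2 0))
      = ((∏ k ∈ s, ‖lam k‖ : ℝ) : ℂ) := by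
  obtain ⟨R, hR1, hR⟩ := exists_one_lt_forall_norm_mul_le hdisk s
  have h := inner_fourierLp_toLp hR1 (differentiableOn_prod_blaschkeFactor hR)
    (circleBlaschke_apply hdisk s) 0
  rw [mulBlaschke_fourierLp_zero]
  refine h.trans ?_
  simp [blaschkeFactor_zero_right]

theorem one_sub_sum_le_prod {ι : Type*} (s : Finset ι) {f : ι → ℝ} (h0 : ∀ i, 0 ≤ f i)
    (h1 : ∀ i, f i ≤ 1) : 1 - ∑ i ∈ s, (1 - f i) ≤ ∏ i ∈ s, f i := by
  classical
  induction s using Finset.induction_on with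
  | empty => simp
  | insert a s ha ih =>
    rw [Finset.sum_insert ha, Finset.prod_insert ha]
    have h2 : ∏ i ∈ s, f i ≤ 1 := Finset.prod_le_one (fun i _ => h0 i) fun i _ => h1 i
    have h3 : 0 ≤ 1 - f a := by linarith [h1 a]
    nlinarith

/-- Both vectors have norm 1. Cancelling the common isometry reduces their inner product to the mean
of the factors with m ≤ k < n, which is ∏ |λ_k|. -/
theorem norm_mulBlaschke_sub_sq_le {m n : ℕ} (hmn : m ≤ n) :
    ‖mulBlaschke hdisk (Finset.range m) (fourierLp 2 0)
      - mulBlaschke hdisk (Finset.range n) (fourierLp 2 0)‖ ^ 2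
      ≤ 2 * ∑ k ∈ Finset.Ico m n, (1 - ‖lam k‖) := by
  have h := one_sub_sum_le_prod (Finset.Ico m n) (f := fun k => ‖lam k‖)
    (fun k => norm_nonneg _) fun k => (hdisk k).le
  rw [norm_sub_sq (𝕜 := ℂ), LinearIsometry.norm_map, LinearIsometry.norm_map, norm_fourierLp,
    ← mulBlaschke_range_mulBlaschke_Ico hdisk hmn, LinearIsometry.inner_map_map,
    inner_fourierLp_zero_mulBlaschke]
  change _ - 2 * (((∏ k ∈ Finset.Ico m n, ‖lam k‖ : ℝ) : ℂ)).re + _ ≤ _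
  rw [Complex.ofReal_re]
  linarith

theorem cauchySeq_mulBlaschke (hsum : Summable fun k => 1 - ‖lam k‖) :
    CauchySeq fun n => mulBlaschke hdisk (Finset.range n) (fourierLp 2 0) := by
  have hb : Tendsto (fun n => √(2 * ∑' k, (1 - ‖lam (k + n)‖))) atTop (𝓝 0) := by
    have h := (tendsto_sum_nat_add fun k => 1 - ‖lam k‖).const_mul 2
    have h' := (Real.continuous_sqrt.tendsto _).comp h
    rwa [mul_zero, Real.sqrt_zero] at h'
  refine cauchySeq_of_le_tendsto_0' _ (fun m n hmn => ?_) hb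
  rw [dist_eq_norm]
  refine Real.le_sqrt_of_sq_le ((norm_mulBlaschke_sub_sq_le hdisk hmn).trans ?_)
  gcongr
  rw [Finset.sum_Ico_eq_sum_range]
  simp_rw [add_comm m]
  exact ((summable_nat_add_iff m).2 hsum).sum_le_tsum (Finset.range (n - m))
    fun k _ => by linarith [hdisk (k + m)]

end Finite

/-! ## Infinite Blaschke products -/

section Infinite

theorem ae_norm_eq_one_of_tendsto {w : ℕ → L2Circle} {v : L2Circle} (h : Tendsto w atTop (𝓝 v))
    (hw : ∀ n, ∀ᵐ t ∂haarAddCircle, ‖w n t‖ = 1) : ∀ᵐ t ∂haarAddCircle, ‖v t‖ = 1 := by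
  obtain ⟨φ, -, hφ⟩ := (tendstoInMeasure_of_tendsto_Lp h).exists_seq_tendsto_ae
  filter_upwards [hφ, ae_all_iff.2 hw] with t h1 h2
  exact tendsto_nhds_unique h1.norm (tendsto_const_nhds.congr fun n => (h2 (φ n)).symm)

theorem exists_Linfty_ae_eq {v : L2Circle} (hv : ∀ᵐ t ∂haarAddCircle, ‖v t‖ = 1) :
    ∃ a : Lp ℂ ∞ (haarAddCircle (T := (1 : ℝ))), v =ᵐ[haarAddCircle] a := by
  have h : MemLp v ∞ (haarAddCircle (T := (1 : ℝ))) :=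
    memLp_top_of_bound (Lp.aestronglyMeasurable v) 1 (hv.mono fun t ht => ht.le)
  exact ⟨h.toLp v, h.coeFn_toLp.symm⟩

/-- For isometries the set of convergence is a closed subspace, and the trigonometric polynomials
are dense. -/
theorem tendsto_of_tendsto_fourierLp {U : ℕ → L2Circle →ₗᵢ[ℂ] L2Circle}
    {W : L2Circle →ₗᵢ[ℂ] L2Circle}
    (h : ∀ k : ℤ, Tendsto (fun n => U n (fourierLp 2 k)) atTop (𝓝 (W (fourierLp 2 k))))
    (f : L2Circle) : Tendsto (fun n => U n f) atTop (𝓝 (W f)) := by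
  let N : Submodule ℂ L2Circle :=
    { carrier := {f | Tendsto (fun n => U n f) atTop (𝓝 (W f))}
      zero_mem' := by simp
      add_mem' := fun {f g} hf hg => by
        change Tendsto (fun n => U n (f + g)) atTop (𝓝 (W (f + g)))
        simpa only [map_add] using Tendsto.add hf hg
      smul_mem' := fun c f hf => by
        change Tendsto (fun n => U n (c • f)) atTop (𝓝 (W (c • f)))
        simpa only [map_smul] using Tendsto.const_smul hf c }
  have hN : IsClosed (N : Set L2Circle) := by
    refine isClosed_of_closure_subset fun f hf => Metric.tendsto_atTop.2 fun ε hε => ?_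
    obtain ⟨g, hg, hfg⟩ := Metric.mem_closure_iff.1 hf (ε / 3) (by positivity)
    obtain ⟨n₀, hn₀⟩ := Metric.tendsto_atTop.1 (show Tendsto _ _ _ from hg) (ε / 3) (by positivity)
    refine ⟨n₀, fun n hn => ?_⟩
    have h1 : dist (U n f) (U n g) = dist f g := (U n).dist_map f g
    have h2 : dist (W g) (W f) = dist f g := by rw [W.dist_map, dist_comm]
    have h3 := dist_triangle4 (U n f) (U n g) (W g) (W f)
    have h4 := hn₀ n hn
    linarith
  have hle : (Submodule.span ℂ (Set.range (fourierLp (T := (1 : ℝ)) 2))).topologicalClosure ≤ N :=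
    Submodule.topologicalClosure_minimal _ (Submodule.span_le.2 (by rintro _ ⟨k, rfl⟩; exact h k))
      hN
  rw [span_fourierLp_closure_eq_top (by simp)] at hle
  exact hle (Submodule.mem_top (x := f))

/-- κ is the reproducing (Szegő) kernel ∑ conj(z)^k t^k: pairing with it evaluates the power series
at z, continuously in x. -/
theorem exists_hasSum_inner_fourierLp {z : ℂ} (hz : ‖z‖ < 1) :
    ∃ κ : L2Circle, ∀ x : L2Circle,
      HasSum (fun k : ℕ => inner ℂ (fourierLp 2 (k : ℤ)) x * z ^ k) (inner ℂ κ x) := by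
  have hs : Summable fun k : ℕ => (conj z ^ k) • (fourierLp 2 (k : ℤ) : L2Circle) := by
    refine Summable.of_norm_bounded (summable_geometric_of_lt_one (norm_nonneg z) hz) fun k => ?_
    rw [norm_smul, norm_fourierLp, mul_one, norm_pow, RCLike.norm_conj]
  refine ⟨_, fun x => ((innerSLFlip ℂ x).hasSum hs.hasSum).congr_fun fun k => ?_⟩
  rw [innerSLFlip_apply_apply, inner_smul_left, map_pow, Complex.conj_conj, mul_comm]

/-- The Taylor coefficients of a function are determined by the sum of its power series. -/
theorem iteratedDeriv_div_factorial_eq {f : ℂ → ℂ} {c : ℕ → ℂ} {C : ℝ} (hc : ∀ k, ‖c k‖ ≤ C)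
    (hf : ∀ z : ℂ, ‖z‖ < 1 → HasSum (fun k => c k * z ^ k) (f z)) (k : ℕ) :
    iteratedDeriv k f 0 / (k.factorial : ℂ) = c k := by
  have h : HasFPowerSeriesOnBall f (FormalMultilinearSeries.ofScalars ℂ c) 0 1 :=
    { r_le := by
        refine FormalMultilinearSeries.le_radius_of_bound _ C (r := 1) fun n => ?_
        rw [FormalMultilinearSeries.ofScalars_norm, NNReal.coe_one, one_pow, mul_one]
        exact hc n
      r_pos := one_pos
      hasSum := fun {y} hy => by
        rw [zero_add]
        have hy' : ‖y‖ < 1 := by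
          rw [← ENNReal.ofReal_one, Metric.eball_ofReal] at hy
          simpa using hy
        refine (hf y hy').congr_fun fun n => ?_
        rw [FormalMultilinearSeries.ofScalars_apply_eq, smul_eq_mul] }
  have h1 := h.analyticAt.hasFPowerSeriesAt.eq_formalMultilinearSeries h.hasFPowerSeriesAt
  exact congrFun (FormalMultilinearSeries.ofScalars_series_injective ℂ ℂ h1) k

variable {lam : ℕ → ℂ} (hdisk : ∀ k, ‖lam k‖ < 1) (hsum : Summable fun k => 1 - ‖lam k‖)

include hdisk hsum in
theorem tendsto_partialBlaschke {z : ℂ} (hz : ‖z‖ < 1) :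
    Tendsto (fun n => partialBlaschke lam n z) atTop (𝓝 (blaschkeProduct lam z)) := by
  have hs : Summable fun k => ‖blaschkeFactor (lam k) z - 1‖ :=
    Summable.of_nonneg_of_le (fun _ => norm_nonneg _)
      (fun k => norm_one_sub_blaschkeFactor_le (hdisk k) hz) (hsum.mul_left _)
  have h := multipliable_one_add_of_summable hs
  simp only [add_sub_cancel] at h
  exact h.hasProd.tendsto_prod_nat

theorem hasSum_partialBlaschke (n : ℕ) {z : ℂ} (hz : ‖z‖ < 1) :
    HasSum (fun k : ℕ => inner ℂ (fourierLp 2 (k : ℤ))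
      (mulBlaschke hdisk (Finset.range n) (fourierLp 2 0)) * z ^ k) (partialBlaschke lam n z) := by
  obtain ⟨R, hR1, hR⟩ := exists_one_lt_forall_norm_mul_le hdisk (Finset.range n)
  have hd := differentiableOn_prod_blaschkeFactor hR
  refine (Complex.hasSum_taylorSeries_on_ball hd (z := z) (by
    rw [mem_ball_zero_iff]
    exact hz.trans hR1)).congr_fun fun k => ?_
  rw [mulBlaschke_fourierLp_zero, inner_fourierLp_toLp hR1 hd (circleBlaschke_apply hdisk _)]
  simp only [smul_eq_mul, sub_zero]
  ring

include hsum in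
-- Evaluation at a point of the disk is continuous on L², so the power series of v sums to lim
-- u_n(z) = u(z). Hence the Taylor coefficients of u are the Fourier coefficients of v, whose
-- negative ones vanish.
theorem boundaryFunction_blaschkeProduct {v : L2Circle}
    (hv : Tendsto (fun n => mulBlaschke hdisk (Finset.range n) (fourierLp 2 0)) atTop (𝓝 v)) :
    boundaryFunction (blaschkeProduct lam) = v := by
  have hvH : v ∈ hardySpace := isClosed_hardySpace.mem_of_tendsto hv (Eventually.of_forall fun n =>
    mulBlaschke_mem_hardySpace hdisk _ (fourierLp_mem_hardySpace 0))
  have hu : ∀ z : ℂ, ‖z‖ < 1 →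
      HasSum (fun k : ℕ => inner ℂ (fourierLp 2 (k : ℤ)) v * z ^ k) (blaschkeProduct lam z) := by
    intro z hz
    obtain ⟨κ, hκ⟩ := exists_hasSum_inner_fourierLp hz
    have h1 : Tendsto (fun n => inner ℂ κ (mulBlaschke hdisk (Finset.range n) (fourierLp 2 0)))
        atTop (𝓝 (inner ℂ κ v)) := tendsto_const_nhds.inner hv
    have h2 : blaschkeProduct lam z = inner ℂ κ v := by
      refine tendsto_nhds_unique (tendsto_partialBlaschke hdisk hsum hz) (h1.congr fun n => ?_)
      exact (hκ _).unique (hasSum_partialBlaschke hdisk n hz)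
    rw [h2]
    exact hκ v
  have hcoeff := iteratedDeriv_div_factorial_eq (C := ‖v‖) (fun k => by
    refine (norm_inner_le_norm _ _).trans ?_
    rw [norm_fourierLp, one_mul]) hu
  have h := fourierBasis.hasSum_repr v
  simp only [HilbertBasis.repr_apply_apply, coe_fourierBasis] at h
  have hinj : Function.Injective (fun k : ℕ => (k : ℤ)) := Nat.cast_injective
  have h3 := (hinj.hasSum_iff (fun n hn => by
    have hn' : n < 0 := by
      by_contra! h0
      exact hn ⟨n.toNat, Int.toNat_of_nonneg h0⟩
    rw [mem_hardySpace.1 hvH n hn', zero_smul])).2 h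
  unfold boundaryFunction
  simp_rw [hcoeff]
  exact h3.tsum_eq

include hsum in
/-- The partial products of an infinite Blaschke product converge strongly, as multiplication
operators, to the multiplication by an inner function. -/
theorem exists_tendsto_mulBlaschke :
    ∃ W : L2Circle →ₗᵢ[ℂ] L2Circle, Function.Surjective W ∧
      (∀ f, Tendsto (fun n => mulBlaschke hdisk (Finset.range n) f) atTop (𝓝 (W f))) ∧
      (∀ f, bilateralShift (W f) = W (bilateralShift f)) ∧
      modelSpace (blaschkeProduct lam) = isometryModel hardySpace W := by
  obtain ⟨v, hv⟩ := cauchySeq_tendsto_of_complete (cauchySeq_mulBlaschke hdisk hsum)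
  have hv1 : ∀ᵐ t ∂haarAddCircle, ‖v t‖ = 1 := by
    refine ae_norm_eq_one_of_tendsto hv fun n => ?_
    rw [mulBlaschke_fourierLp_zero]
    filter_upwards [ContinuousMap.coeFn_toLp (p := 2) (𝕜 := ℂ) haarAddCircle
      (circleBlaschke hdisk (Finset.range n))] with t ht
    rw [ht, norm_circleBlaschke]
  obtain ⟨a, hva⟩ := exists_Linfty_ae_eq hv1
  have ha : ∀ᵐ t ∂haarAddCircle, ‖a t‖ = 1 := by
    filter_upwards [hv1, hva] with t h1 h2
    rw [← h2, h1]
  have hmulv : ∀ k : ℤ, mulOp a (fourierLp 2 k) = mulCont (fourier k) v := by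
    intro k
    refine Lp.ext ?_
    filter_upwards [coeFn_mulOp a (fourierLp 2 k), coeFn_mulCont (fourier k) v,
      coeFn_fourierLp 2 k, hva] with t h1 h2 h3 h4
    rw [h1, h2, h3, h4, mul_comm]
  refine ⟨unimodularMul a ha, unimodularMul_surjective a ha, tendsto_of_tendsto_fourierLp fun k => ?_,
    fun f => mulOp_comm _ _ f, ?_⟩
  -- Multiplication by t^k commutes with everything, so u_n t^k → v t^k follows from the case k = 0.
  · rw [unimodularMul_apply, hmulv]
    refine (((mulCont (fourier k)).continuous.tendsto v).comp hv).congr fun n => ?_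
    have h1 : (fourierLp 2 k : L2Circle) = mulCont (fourier k) (fourierLp 2 0) := by
      rw [mulCont_fourier_fourierLp, add_zero]
    rw [h1]
    exact mulOp_comm _ _ _
  · rw [modelSpace, boundaryFunction_blaschkeProduct hdisk hsum hv, mulHardySpace_eq_map v a ha hva]
    rfl

end Infinite

/-! ## Truncated Toeplitz operators with continuous symbols -/

section TruncatedToeplitz

variable (u : ℂ → ℂ)

theorem inner_proj (x : ModelSpace u) (y : L2Circle) :
    inner ℂ x (ModelSpace.proj u y) = inner ℂ (ModelSpace.incl u x) y :=
  ((modelSpace u).inner_orthogonalProjectionOnto_eq_of_mem_left x y)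

/-- The map `a ↦ T_u(a)` for continuous `a`. -/
def truncatedToeplitzCont :
    C(AddCircle (1 : ℝ), ℂ) →L[ℂ] ModelSpace u →L[ℂ] ModelSpace u :=
  (ContinuousLinearMap.compL ℂ (ModelSpace u) L2Circle (ModelSpace u) (ModelSpace.proj u)) ∘L
    ((ContinuousLinearMap.compL ℂ (ModelSpace u) L2Circle L2Circle).flip (ModelSpace.incl u)) ∘L
      mulCont

theorem truncatedToeplitzCont_eq (a : C(AddCircle (1 : ℝ), ℂ)) :
    truncatedToeplitzCont u a = ModelSpace.proj u ∘L mulCont a ∘L ModelSpace.incl u := rfl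

theorem truncatedToeplitz_toLp (a : C(AddCircle (1 : ℝ), ℂ)) :
    truncatedToeplitz u (ContinuousMap.toLp ∞ haarAddCircle ℂ a) = truncatedToeplitzCont u a := rfl

theorem truncatedToeplitzCont_star (a : C(AddCircle (1 : ℝ), ℂ)) :
    truncatedToeplitzCont u (star a) = star (truncatedToeplitzCont u a) := by
  rw [ContinuousLinearMap.star_eq_adjoint, ContinuousLinearMap.eq_adjoint_iff]
  intro x y
  simp only [truncatedToeplitzCont_eq, ContinuousLinearMap.comp_apply]
  rw [inner_proj, ← inner_conj_symm, inner_proj, ← inner_mulCont_left, inner_conj_symm]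

/-- Adjoints supply the negative powers of t; linearity, continuity and density of the trigonometric
polynomials do the rest. -/
theorem truncatedToeplitzCont_mem {A : StarSubalgebra ℂ (ModelSpace u →L[ℂ] ModelSpace u)}
    (hA : IsClosed (A : Set (ModelSpace u →L[ℂ] ModelSpace u)))
    (h : ∀ k : ℕ, truncatedToeplitzCont u (fourier k) ∈ A) (a : C(AddCircle (1 : ℝ), ℂ)) :
    truncatedToeplitzCont u a ∈ A := by
  have hle : (Submodule.span ℂ (Set.range (fourier (T := (1 : ℝ))))).topologicalClosure
      ≤ (Subalgebra.toSubmodule A.toSubalgebra).comap (truncatedToeplitzCont u).toLinearMap := by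
    refine Submodule.topologicalClosure_minimal _ (Submodule.span_le.2 ?_)
      (hA.preimage (truncatedToeplitzCont u).continuous)
    rintro _ ⟨n, rfl⟩
    change truncatedToeplitzCont u (fourier n) ∈ A
    obtain ⟨k, rfl | rfl⟩ := n.eq_nat_or_neg
    · exact h k
    · rw [← star_fourier, truncatedToeplitzCont_star]
      exact star_mem (h k)
  rw [span_fourier_closure_eq_top] at hle
  exact hle (Submodule.mem_top (x := a))

theorem fourier_natCast_eq_pow (k : ℕ) :
    (fourier (k : ℤ) : C(AddCircle (1 : ℝ), ℂ)) = fourier 1 ^ k := by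
  induction k with
  | zero =>
    ext t
    simp
  | succ k ih => rw [pow_succ, ← ih, fourier_mul_fourier, Nat.cast_succ]

end TruncatedToeplitz

end

theorem corollary4p16 (lam : ℕ → ℂ) (hdisk : ∀ k, ‖lam k‖ < 1)
    (hmono : Monotone fun k => ‖lam k‖) (hsum : Summable fun k => 1 - ‖lam k‖) :
    IsHilbertFiltration (modelFiltration lam) ∧
      fsdAlgebra lam ≤ convergentAlgebra (modelFiltration lam) ∧
      IsFractal (fsdAlgebra lam) := by
  obtain ⟨W, hW, hlim, hSW, hmodel⟩ := exists_tendsto_mulBlaschke hdisk hsum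
  set u := blaschkeProduct lam with hu
  -- The filtration starts with u_1 at index 0, hence the shift to n + 1 factors.
  set U : ℕ → L2Circle →ₗᵢ[ℂ] L2Circle := fun n => mulBlaschke hdisk (Finset.range (n + 1)) with hU
  have hι : ∀ x, ModelSpace.incl u x ∈ isometryModel hardySpace W := fun x => hmodel ▸ x.2
  have hιs : ∀ y ∈ isometryModel hardySpace W, ∃ x, ModelSpace.incl u x = y :=
    fun y hy => ⟨⟨y, hmodel ▸ hy⟩, rfl⟩
  have hι1 : ∀ x, ‖ModelSpace.incl u x‖ = ‖x‖ := fun _ => rfl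
  have hp := inner_proj u
  have hV : ∀ n x, x ∈ modelFiltration lam n ↔
      ModelSpace.incl u x ∈ isometryModel hardySpace (U n) := fun n x => by
    rw [hU, ← modelSpace_partialBlaschke hdisk (n + 1)]
    rfl
  have hanti : Antitone fun n => hardySpace.map (U n).toLinearMap := fun m n hmn =>
    antitone_map_mulBlaschke_range hdisk (Nat.succ_le_succ hmn)
  have hlim' : ∀ f, Tendsto (fun n => U n f) atTop (𝓝 (W f)) :=
    fun f => (hlim f).comp (tendsto_add_atTop_nat 1)
  have hUM : ∀ n, ∀ x ∈ hardySpace, U n x ∈ hardySpace :=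
    fun n x hx => mulBlaschke_mem_hardySpace hdisk _ hx
  have hWM : ∀ x ∈ hardySpace, W x ∈ hardySpace := fun x hx =>
    isClosed_hardySpace.mem_of_tendsto (hlim' x) (Eventually.of_forall fun n => hUM n x hx)
  have hSM : ∀ x ∈ hardySpace, bilateralShift x ∈ hardySpace :=
    fun x hx => bilateralShift_mem_hardySpace hx
  have hfil : IsHilbertFiltration (modelFiltration lam) :=
    isHilbertFiltration_of_isometries hι hιs hι1 hV hanti hlim' hUM hW
      fun n => finiteDimensional_isometryModel_mulBlaschke_range hdisk (n + 1)
  have hshift := compression_shift_mem_asymptoticCommutant hι hιs hι1 hp hV hanti hlim' hUM hSM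
    (fun n x => mulOp_comm _ _ x) (fourierLp_mem_hardySpace 0) (norm_fourierLp 0)
    isometryModel_bilateralShift_le
  have hT : ∀ a, truncatedToeplitzCont u a ∈ asymptoticCommutant (modelFiltration lam) := by
    refine truncatedToeplitzCont_mem u (isClosed_asymptoticCommutant _) fun k => ?_
    have h := compression_shift_pow hι hιs hι1 hp hSM hWM hSW k
    rw [truncatedToeplitzCont_eq, fourier_natCast_eq_pow, mulCont_pow]
    exact h ▸ pow_mem hshift k
  have hle : fsdAlgebra lam ≤ essentialSectionAlgebra (modelFiltration lam) := by
    refine NonUnitalStarSubalgebra.topologicalClosure_minimal _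
      (NonUnitalStarAlgebra.adjoin_le ?_) (isClosed_essentialSectionAlgebra hfil)
    rintro _ ⟨a, K, hK, rfl⟩
    -- A generator is exactly a sequence of finite sections, so its defect is identically zero.
    refine ⟨_, add_mem (hT a) (mem_asymptoticCommutant_of_isCompactOperator hfil hK), ?_⟩
    refine tendsto_const_nhds.congr fun n => ?_
    rw [truncatedToeplitz_toLp, sub_self, norm_zero]
  exact ⟨hfil, hle.trans (essentialSectionAlgebra_le_convergentAlgebra hfil),
    isFractal_of_le_essentialSectionAlgebra hfil hle⟩
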